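/- Let $\mathbb F\in\{\mathbb R,\mathbb C\}$. All Hilbert spaces are over $\mathbb F$ and may be nonseparable; inner products are linear in the first argument. For a Hilbert space $H$ let $\overline H$ be its conjugate (the same additive group and norm, with $\lambda * x=\overline\lambda x$ and $\langle x,y\rangle_{\overline H}=\langle y,x\rangle_H$) and $J_H:H\to\overline H$, $x\mapsto x$. Let $H\otimes K$ denote the Hilbert space tensor product, i.e. the completion of the algebraic tensor product $H\otimes_{\rm alg}K$ for the inner product with $\langle x_1\otimes y_1,x_2\otimes y_2\rangle=\langle x_1,x_2\rangle\langle y_1,y_2\rangle$. For normed spaces $E,F$ and families $(x_i)$ in $E$, $(y_i)$ in $F$ put $\ell_2(x_i)=(\sum_i\|x_i\|^2)^{1/2}$ and $w_2(y_i)=\sup_{\|b\|_{F'}\le1}(\sum_i|\langle y_i,b\rangle|^2)^{1/2}$. A bounded operator $T:E\to F$ is absolutely $2$-summing if for some $c\ge0$ one has $\ell_2(Tx_i)\le c\,w_2(x_i)$ for all finite families in $E$; $\mathbf P_2(T)$ is the infimum of these $c$, and $\mathfrak P_2(E,F)$ is the space of all such $T$ with the norm $\mathbf P_2$. $T$ is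 $2$-nuclear if $T=\sum_{n=1}^\infty\langle\cdot,a_n\rangle y_n$ in operator norm for some $a_n\in E'$, $y_n\in F$ with $\ell_2(a_n)<\infty$, $w_2(y_n)<\infty$; $\mathbf N_2(T)$ is the infimum of $\ell_2(a_n)\,w_2(y_n)$ over all such representations, and $\mathfrak N_2(E,F)$ is the space of all such $T$ with the norm $\mathbf N_2$. For $z\in E\otimes_{\rm alg}F$ let $g_2(z;E,F)=\inf\{\ell_2(x_i)\,w_2(y_i): z=\sum_{i=1}^n x_i\otimes y_i\}$. A tensor norm $\alpha$ assigns to all normed spaces $E,F$ a norm on $E\otimes_{\rm alg}F$ with $\varepsilon\le\alpha\le\pi$ ($\varepsilon$ the injective, $\pi$ the projective norm) and $\alpha((S\otimes T)z)\le\|S\|\|T\|\alpha(z)$ for bounded operators $S,T$. It is totally accessible if for all $E,F,z$ the infimum of $\alpha(z;M,N)$ over finite-dimensional subspaces $M\subseteq E$, $N\subseteq F$ with $z\in M\otimes N$ equals the supremum of $\alpha((Q_M\otimes Q_N)z;E/M,F/N)$ over closed finite-codimensional subspaces $M\subseteq E$, $N\subseteq F$ ($Q_M,Q_N$ the quotient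 maps). Further, $\alpha^t(z;E,F)=\alpha(z^t;F,E)$, where $z^t$ is the transposed tensor; $\alpha'(z;M,N)=\sup\{|\langle\varphi,z\rangle|:\varphi\in M'\otimes N',\ \alpha(\varphi;M',N')\le1\}$ for finite-dimensional $M,N$, and $\alpha'(z;E,F)=\inf\alpha'(z;M,N)$ over finite-dimensional $M\subseteq E$, $N\subseteq F$ with $z\in M\otimes N$; and $\alpha^*=(\alpha^t)'$. Proposition. Let $H,K,H_1,H_2,K_1,K_2$ be Hilbert spaces. (1) $\mathfrak P_2(\overline H,K)=\mathfrak N_2(\overline H,K)$ with $\mathbf P_2=\mathbf N_2$, and there is a unique linear isometric isomorphism $H\otimes K\cong\mathfrak P_2(\overline H,K)$ that maps $x\otimes y$ to $\langle\cdot,J_Hx\rangle_{\overline H}\,y$ for all $x\in H$, $y\in K$. (2) $g_2$ is a totally accessible tensor norm, and for every $z\in H\otimes_{\rm alg}K$ the norm of $z$ in the Hilbert space $H\otimes K$ equals $g_2(z;H,K)=g_2^t(z;H,K)=g_2^*(z;H,K)=g_2'(z;H,K)$. Hence the identity of $H\otimes_{\rm alg}K$ extends uniquely to a linear isometric isomorphism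 of $H\otimes K$ onto the completion $H\widetilde\otimes_{g_2}K$ of $(H\otimes_{\rm alg}K,g_2)$. (3) Between Hilbert spaces $\mathbf P_2$ is induced by an inner product, and isometrically $$\mathfrak P_2(H_1\otimes H_2,K_1\otimes K_2)\cong\mathfrak P_2(H_1,\overline{K_1})\otimes\mathfrak P_2(H_2,K_2)\cong\mathfrak P_2(H_1,K_2)\otimes\mathfrak P_2(H_2,\overline{K_1}).$$ More precisely, there is a linear isometric isomorphism $K_1\to\overline{K_1}$, and for each such isomorphism $C$ there are unique linear isometric isomorphisms of $\mathfrak P_2(H_1,\overline{K_1})\otimes\mathfrak P_2(H_2,K_2)$ and of $\mathfrak P_2(H_1,K_2)\otimes\mathfrak P_2(H_2,\overline{K_1})$ onto $\mathfrak P_2(H_1\otimes H_2,K_1\otimes K_2)$ that map $S\otimes T$ to the operator with $x_1\otimes x_2\mapsto C^{-1}Sx_1\otimes Tx_2$ and with $x_1\otimes x_2\mapsto C^{-1}Tx_2\otimes Sx_1$, respectively. Without any choice, there are unique linear isometric isomorphisms of $\mathfrak P_2(H_1,K_1)\otimes\mathfrak P_2(H_2,K_2)$ and of $\mathfrak P_2(H_1,K_2)\otimes\mathfrak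 P_2(H_2,K_1)$ onto $\mathfrak P_2(H_1\otimes H_2,K_1\otimes K_2)$ that map $S\otimes T$ to the operator with $x_1\otimes x_2\mapsto Sx_1\otimes Tx_2$ and with $x_1\otimes x_2\mapsto Tx_2\otimes Sx_1$, respectively. -/

import Mathlib

open scoped ENNReal NNReal TensorProduct ComplexConjugate

noncomputable section

/-! ### The conjugate Hilbert space -/

/-- The conjugate `H̄` of a Hilbert space `H`: the same additive group and norm, with scalar
multiplication `c ∗ x = conj c • x` and inner product `⟪x, y⟫_H̄ = ⟪y, x⟫_H`. -/
def ConjSpace (_𝕜 : Type*) (H : Type*) : Type _ := H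

namespace ConjSpace

variable {𝕜 : Type*} [RCLike 𝕜] {H : Type*} [NormedAddCommGroup H] [InnerProductSpace 𝕜 H]

instance : NormedAddCommGroup (ConjSpace 𝕜 H) := inferInstanceAs (NormedAddCommGroup H)

instance [CompleteSpace H] : CompleteSpace (ConjSpace 𝕜 H) := inferInstanceAs (CompleteSpace H)

/-- The identity of the underlying additive groups, `H → H̄`. -/
def toConj : H ≃+ ConjSpace 𝕜 H := AddEquiv.refl H

instance : Module 𝕜 (ConjSpace 𝕜 H) where
  smul c x := toConj (conj c • toConj.symm x)
  one_smul x := by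
    change toConj (conj (1 : 𝕜) • toConj.symm x) = x
    simp
  mul_smul a b x := by
    change toConj (conj (a * b) • toConj.symm x)
      = toConj (conj a • toConj.symm (toConj (conj b • toConj.symm x)))
    simp [mul_smul]
  smul_zero a := by
    change toConj (conj a • toConj.symm (0 : ConjSpace 𝕜 H)) = 0
    simp
  smul_add a x y := by
    change toConj (conj a • toConj.symm (x + y))
      = toConj (conj a • toConj.symm x) + toConj (conj a • toConj.symm y)
    simp
  add_smul a b x := by
    change toConj (conj (a + b) • toConj.symm x)
      = toConj (conj a • toConj.symm x) + toConj (conj b • toConj.symm x)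
    simp [add_smul]
  zero_smul x := by
    change toConj (conj (0 : 𝕜) • toConj.symm x) = 0
    simp

theorem smul_def (c : 𝕜) (x : ConjSpace 𝕜 H) : c • x = toConj (conj c • toConj.symm x) := rfl

instance : InnerProductSpace 𝕜 (ConjSpace 𝕜 H) where
  norm_smul_le c x := by
    change ‖conj c • toConj.symm x‖ ≤ ‖c‖ * ‖toConj.symm x‖
    simp [norm_smul]
  inner x y := inner 𝕜 (toConj.symm y) (toConj.symm x)
  norm_sq_eq_re_inner x := norm_sq_eq_re_inner (𝕜 := 𝕜) (toConj.symm x)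
  conj_inner_symm x y := inner_conj_symm (toConj.symm y) (toConj.symm x)
  add_left x y z := by
    change inner 𝕜 (toConj.symm z) (toConj.symm (x + y)) = _
    simp [inner_add_right]
  smul_left x y r := by
    change inner 𝕜 (toConj.symm y) (toConj.symm (r • x)) = _
    simp [smul_def, inner_smul_right]

/-- The canonical antiunitary operator `J_H : H → H̄`, `x ↦ x`. -/
def J : H ≃ₗᵢ⋆[𝕜] ConjSpace 𝕜 H where
  toFun := toConj
  map_add' := map_add toConj
  map_smul' c x := by simp [smul_def]
  invFun := toConj.symm
  left_inv _ := rfl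
  right_inv _ := rfl
  norm_map' _ := rfl

end ConjSpace

/-! ### Strong and weak `ℓ₂`-norms of families -/

/-- `(∑ᵢ ‖xᵢ‖²)^{1/2}`, with value in `[0, ∞]`. -/
def strongL2 {ι E : Type*} [NormedAddCommGroup E] (x : ι → E) : ℝ≥0∞ :=
  (∑' i, ‖x i‖ₑ ^ 2) ^ (1 / 2 : ℝ)

/-- `sup_{‖b‖ ≤ 1} (∑ᵢ |⟨yᵢ, b⟩|²)^{1/2}`, the supremum being taken over the closed unit ball of the
dual, with value in `[0, ∞]`. -/
def weakL2 (𝕜 : Type*) [RCLike 𝕜] {ι F : Type*} [NormedAddCommGroup F] [NormedSpace 𝕜 F]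
    (y : ι → F) : ℝ≥0∞ :=
  ⨆ (b : StrongDual 𝕜 F) (_ : ‖b‖ ≤ 1), strongL2 (fun i => b (y i))

/-! ### Absolutely `2`-summing and `2`-nuclear operators -/

section Operators

variable {𝕜 : Type*} [RCLike 𝕜] {E F : Type*} [NormedAddCommGroup E] [NormedSpace 𝕜 E]
  [NormedAddCommGroup F] [NormedSpace 𝕜 F]

/-- `c` is admissible in the inequality that defines absolutely `2`-summing operators. -/
def TwoSummingBound (T : E →L[𝕜] F) (c : ℝ≥0) : Prop :=
  ∀ (n : ℕ) (x : Fin n → E), strongL2 (fun i => T (x i)) ≤ c * weakL2 𝕜 x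

/-- `T` is absolutely `2`-summing. -/
def IsTwoSumming (T : E →L[𝕜] F) : Prop := ∃ c : ℝ≥0, TwoSummingBound T c

/-- The `2`-summing norm `P₂(T)`; it is `∞` if `T` is not absolutely `2`-summing. -/
def twoSummingNorm (T : E →L[𝕜] F) : ℝ≥0∞ := ⨅ (c : ℝ≥0) (_ : TwoSummingBound T c), (c : ℝ≥0∞)

/-- `T = ∑ₙ ⟨·, aₙ⟩ yₙ`, convergent in operator norm, with `(aₙ)` strongly and `(yₙ)` weakly
`2`-summable. -/
structure IsTwoNuclearRep (T : E →L[𝕜] F) (a : ℕ → StrongDual 𝕜 E) (y : ℕ → F) : Prop where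
  strong_lt_top : strongL2 a < ∞
  weak_lt_top : weakL2 𝕜 y < ∞
  tendsto : Filter.Tendsto (fun N => ∑ n ∈ Finset.range N, (a n).smulRight (y n))
    Filter.atTop (nhds T)

/-- `T` is `2`-nuclear. -/
def IsTwoNuclear (T : E →L[𝕜] F) : Prop := ∃ a y, IsTwoNuclearRep T a y

/-- The `2`-nuclear norm `N₂(T)`; it is `∞` if `T` is not `2`-nuclear. -/
def twoNuclearNorm (T : E →L[𝕜] F) : ℝ≥0∞ :=
  ⨅ (a : ℕ → StrongDual 𝕜 E) (y : ℕ → F) (_ : IsTwoNuclearRep T a y), strongL2 a * weakL2 𝕜 y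

end Operators

/-! ### Tensor norms -/

/-- Functionals on all algebraic tensor products of normed spaces (in given universes). -/
abbrev TensorFunctional.{u, v} (𝕜 : Type) [RCLike 𝕜] : Type (max (u + 1) (v + 1)) :=
  ∀ (E : Type u) [NormedAddCommGroup E] [NormedSpace 𝕜 E]
    (F : Type v) [NormedAddCommGroup F] [NormedSpace 𝕜 F], E ⊗[𝕜] F → ℝ≥0∞

/-- The injective norm `ε(z; E, F)`. -/
def injNorm.{u, v} (𝕜 : Type) [RCLike 𝕜] : TensorFunctional.{u, v} 𝕜 :=
  fun E _ _ F _ _ z => ⨆ (a : StrongDual 𝕜 E) (_ : ‖a‖ ≤ 1) (b : StrongDual 𝕜 F) (_ : ‖b‖ ≤ 1),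
    ‖TensorProduct.dualDistrib 𝕜 E F ((a : E →ₗ[𝕜] 𝕜) ⊗ₜ[𝕜] (b : F →ₗ[𝕜] 𝕜)) z‖ₑ

/-- The projective norm `π(z; E, F)`. -/
def projNorm.{u, v} (𝕜 : Type) [RCLike 𝕜] : TensorFunctional.{u, v} 𝕜 :=
  fun E _ _ F _ _ z => ⨅ (n : ℕ) (x : Fin n → E) (y : Fin n → F) (_ : z = ∑ i, x i ⊗ₜ[𝕜] y i),
    ∑ i, ‖x i‖ₑ * ‖y i‖ₑ

/-- `g₂(z; E, F) = inf { (∑ ‖xᵢ‖²)^{1/2} sup_{‖b‖ ≤ 1} (∑ |⟨yᵢ, b⟩|²)^{1/2} : z = ∑ xᵢ ⊗ yᵢ }`. -/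
def g2.{u, v} (𝕜 : Type) [RCLike 𝕜] : TensorFunctional.{u, v} 𝕜 :=
  fun E _ _ F _ _ z => ⨅ (n : ℕ) (x : Fin n → E) (y : Fin n → F) (_ : z = ∑ i, x i ⊗ₜ[𝕜] y i),
    strongL2 x * weakL2 𝕜 y

/-- Tensor norms on the class of normed spaces: a norm on each `E ⊗ F` lying between `ε` and `π`,
with the metric mapping property. -/
structure IsTensorNorm.{u, v} {𝕜 : Type} [RCLike 𝕜] (α : TensorFunctional.{u, v} 𝕜) : Prop where
  lt_top : ∀ (E : Type u) [NormedAddCommGroup E] [NormedSpace 𝕜 E]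
    (F : Type v) [NormedAddCommGroup F] [NormedSpace 𝕜 F] (z : E ⊗[𝕜] F), α E F z < ∞
  add_le : ∀ (E : Type u) [NormedAddCommGroup E] [NormedSpace 𝕜 E]
    (F : Type v) [NormedAddCommGroup F] [NormedSpace 𝕜 F] (z w : E ⊗[𝕜] F),
    α E F (z + w) ≤ α E F z + α E F w
  smul_eq : ∀ (E : Type u) [NormedAddCommGroup E] [NormedSpace 𝕜 E]
    (F : Type v) [NormedAddCommGroup F] [NormedSpace 𝕜 F] (c : 𝕜) (z : E ⊗[𝕜] F),
    α E F (c • z) = ‖c‖ₑ * α E F z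
  eq_zero : ∀ (E : Type u) [NormedAddCommGroup E] [NormedSpace 𝕜 E]
    (F : Type v) [NormedAddCommGroup F] [NormedSpace 𝕜 F] (z : E ⊗[𝕜] F), α E F z = 0 → z = 0
  inj_le : ∀ (E : Type u) [NormedAddCommGroup E] [NormedSpace 𝕜 E]
    (F : Type v) [NormedAddCommGroup F] [NormedSpace 𝕜 F] (z : E ⊗[𝕜] F),
    injNorm 𝕜 E F z ≤ α E F z
  le_proj : ∀ (E : Type u) [NormedAddCommGroup E] [NormedSpace 𝕜 E]
    (F : Type v) [NormedAddCommGroup F] [NormedSpace 𝕜 F] (z : E ⊗[𝕜] F),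
    α E F z ≤ projNorm 𝕜 E F z
  map_le : ∀ (E₁ : Type u) [NormedAddCommGroup E₁] [NormedSpace 𝕜 E₁]
    (E₂ : Type u) [NormedAddCommGroup E₂] [NormedSpace 𝕜 E₂]
    (F₁ : Type v) [NormedAddCommGroup F₁] [NormedSpace 𝕜 F₁]
    (F₂ : Type v) [NormedAddCommGroup F₂] [NormedSpace 𝕜 F₂]
    (S : E₁ →L[𝕜] E₂) (T : F₁ →L[𝕜] F₂) (z : E₁ ⊗[𝕜] F₁),
    α E₂ F₂ (TensorProduct.map (S : E₁ →ₗ[𝕜] E₂) (T : F₁ →ₗ[𝕜] F₂) z)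
      ≤ ‖S‖ₑ * ‖T‖ₑ * α E₁ F₁ z

/-- The finite hull: `inf { α(w; M, N) }` over finite-dimensional subspaces `M ⊆ E`, `N ⊆ F` and
`w ∈ M ⊗ N` representing `z`. -/
def finHull.{u, v} {𝕜 : Type} [RCLike 𝕜] (α : TensorFunctional.{u, v} 𝕜) :
    TensorFunctional.{u, v} 𝕜 :=
  fun E _ _ F _ _ z => ⨅ (M : Submodule 𝕜 E) (_ : FiniteDimensional 𝕜 M)
    (N : Submodule 𝕜 F) (_ : FiniteDimensional 𝕜 N)
    (w : M ⊗[𝕜] N) (_ : TensorProduct.map M.subtype N.subtype w = z), α M N w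

/-- The cofinite hull: `sup { α((Q_M ⊗ Q_N) z; E/M, F/N) }` over closed finite-codimensional
subspaces `M ⊆ E`, `N ⊆ F`, where `Q_M`, `Q_N` are the quotient maps. -/
def cofinHull.{u, v} {𝕜 : Type} [RCLike 𝕜] (α : TensorFunctional.{u, v} 𝕜) :
    TensorFunctional.{u, v} 𝕜 :=
  fun E _ _ F _ _ z => ⨆ (M : Submodule 𝕜 E) (_ : IsClosed (M : Set E))
    (_ : FiniteDimensional 𝕜 (E ⧸ M)) (N : Submodule 𝕜 F) (_ : IsClosed (N : Set F))
    (_ : FiniteDimensional 𝕜 (F ⧸ N)),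
    α (E ⧸ M) (F ⧸ N) (TensorProduct.map M.mkQ N.mkQ z)

/-- `α` is totally accessible: its finite hull and its cofinite hull coincide. -/
def IsTotallyAccessible.{u, v} {𝕜 : Type} [RCLike 𝕜] (α : TensorFunctional.{u, v} 𝕜) : Prop :=
  ∀ (E : Type u) [NormedAddCommGroup E] [NormedSpace 𝕜 E]
    (F : Type v) [NormedAddCommGroup F] [NormedSpace 𝕜 F] (z : E ⊗[𝕜] F),
    finHull α E F z = cofinHull α E F z

/-- The transposed tensor norm `αᵗ(z; E, F) = α(zᵗ; F, E)`. -/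
def transposeNorm.{u, v} {𝕜 : Type} [RCLike 𝕜] (α : TensorFunctional.{v, u} 𝕜) :
    TensorFunctional.{u, v} 𝕜 :=
  fun E _ _ F _ _ z => α F E (TensorProduct.comm 𝕜 E F z)

/-- Trace duality `sup { |⟨φ, z⟩| : φ ∈ E' ⊗ F', α(φ; E', F') ≤ 1 }`. -/
def traceDualNorm.{u, v} {𝕜 : Type} [RCLike 𝕜] (α : TensorFunctional.{u, v} 𝕜) :
    TensorFunctional.{u, v} 𝕜 :=
  fun E _ _ F _ _ z => ⨆ (φ : StrongDual 𝕜 E ⊗[𝕜] StrongDual 𝕜 F)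
    (_ : α (StrongDual 𝕜 E) (StrongDual 𝕜 F) φ ≤ 1),
    ‖TensorProduct.dualDistrib 𝕜 E F
      (TensorProduct.map (ContinuousLinearMap.coeLM 𝕜) (ContinuousLinearMap.coeLM 𝕜) φ) z‖ₑ

/-- The dual tensor norm `α'`: `M ⊗_{α'} N = (M' ⊗_α N')'` for finite-dimensional `M`, `N`, extended
to all normed spaces by the finite hull. -/
def dualNorm.{u, v} {𝕜 : Type} [RCLike 𝕜] (α : TensorFunctional.{u, v} 𝕜) :
    TensorFunctional.{u, v} 𝕜 :=
  finHull (traceDualNorm α)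

/-- The adjoint tensor norm `α^* = (αᵗ)'`. -/
def adjointNorm.{u, v} {𝕜 : Type} [RCLike 𝕜] (α : TensorFunctional.{v, u} 𝕜) :
    TensorFunctional.{u, v} 𝕜 :=
  dualNorm (transposeNorm α)


/-! ### The normed space of absolutely `2`-summing operators -/

section TwoSummingSpace

theorem strongL2_fin {n : ℕ} {E : Type*} [NormedAddCommGroup E] (x : Fin n → E) :
    strongL2 x = (∑ i, ‖x i‖ₑ ^ 2) ^ (1 / 2 : ℝ) := by
  rw [strongL2, tsum_fintype]

theorem strongL2_sq {ι E : Type*} [NormedAddCommGroup E] (x : ι → E) :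
    strongL2 x ^ 2 = ∑' i, ‖x i‖ₑ ^ 2 := by
  rw [strongL2, ← ENNReal.rpow_natCast, ← ENNReal.rpow_mul]
  norm_num

theorem strongL2_add_le {n : ℕ} {E : Type*} [NormedAddCommGroup E] (x y : Fin n → E) :
    strongL2 (fun i => x i + y i) ≤ strongL2 x + strongL2 y := by
  simp only [strongL2_fin]
  have h := ENNReal.Lp_add_le Finset.univ (fun i => ‖x i‖ₑ) (fun i => ‖y i‖ₑ)
    (p := 2) (by norm_num)
  simp only [ENNReal.rpow_two] at h
  refine le_trans ?_ h
  gcongr with i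
  exact enorm_add_le _ _

theorem strongL2_smul {ι 𝕜 E : Type*} [RCLike 𝕜] [NormedAddCommGroup E] [NormedSpace 𝕜 E]
    (c : 𝕜) (x : ι → E) : strongL2 (fun i => c • x i) = ‖c‖ₑ * strongL2 x := by
  simp only [strongL2, enorm_smul, mul_pow, ENNReal.tsum_mul_left]
  rw [ENNReal.mul_rpow_of_nonneg _ _ (by norm_num), ← ENNReal.rpow_natCast, ← ENNReal.rpow_mul]
  norm_num

theorem strongL2_fin_lt_top {n : ℕ} {E : Type*} [NormedAddCommGroup E] (x : Fin n → E) :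
    strongL2 x < ∞ := by
  rw [strongL2_fin]
  refine ENNReal.rpow_lt_top_of_nonneg (by norm_num) (ne_of_lt ?_)
  exact ENNReal.sum_lt_top.2 fun i _ => ENNReal.pow_lt_top enorm_lt_top

variable {𝕜 : Type*} [RCLike 𝕜] {E F : Type*} [NormedAddCommGroup E] [NormedSpace 𝕜 E]
  [NormedAddCommGroup F] [NormedSpace 𝕜 F]

theorem strongL2_le_weakL2 {ι : Type*} (y : ι → F) (b : StrongDual 𝕜 F) (hb : ‖b‖ ≤ 1) :
    strongL2 (fun i => b (y i)) ≤ weakL2 𝕜 y :=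
  le_iSup₂_of_le b hb le_rfl

theorem weakL2_le_strongL2 {ι : Type*} (y : ι → F) : weakL2 𝕜 y ≤ strongL2 y := by
  refine iSup₂_le fun b hb => ?_
  unfold strongL2
  gcongr with i
  refine (b.le_opENorm _).trans ?_
  have : ‖b‖ₑ ≤ 1 := by rw [← ofReal_norm]; exact ENNReal.ofReal_le_one.2 hb
  calc ‖b‖ₑ * ‖y i‖ₑ ≤ 1 * ‖y i‖ₑ := by gcongr
    _ = ‖y i‖ₑ := one_mul _

theorem weakL2_smul {ι : Type*} (c : 𝕜) (y : ι → F) :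
    weakL2 𝕜 (fun i => c • y i) = ‖c‖ₑ * weakL2 𝕜 y := by
  simp only [weakL2, ENNReal.mul_iSup]
  refine iSup_congr fun b => iSup_congr fun _ => ?_
  rw [← strongL2_smul]
  simp

theorem weakL2_fin_lt_top {n : ℕ} (y : Fin n → F) : weakL2 𝕜 y < ∞ :=
  (weakL2_le_strongL2 y).trans_lt (strongL2_fin_lt_top y)

theorem isTwoSumming_iff {T : E →L[𝕜] F} : IsTwoSumming T ↔ twoSummingNorm T < ∞ := by
  constructor
  · rintro ⟨c, hc⟩
    exact (iInf₂_le c hc).trans_lt ENNReal.coe_lt_top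
  · intro h
    simp only [twoSummingNorm, iInf_lt_iff] at h
    obtain ⟨c, hc, -⟩ := h
    exact ⟨c, hc⟩

theorem strongL2_le_twoSummingNorm_mul {T : E →L[𝕜] F} (hT : IsTwoSumming T) {n : ℕ}
    (x : Fin n → E) : strongL2 (fun i => T (x i)) ≤ twoSummingNorm T * weakL2 𝕜 x := by
  have hw := (weakL2_fin_lt_top (𝕜 := 𝕜) x).ne
  have : Nonempty {c : ℝ≥0 // TwoSummingBound T c} := by
    obtain ⟨c, hc⟩ := hT
    exact ⟨⟨c, hc⟩⟩
  rw [twoSummingNorm, iInf_subtype', ENNReal.iInf_mul (fun h => absurd h hw)]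
  · exact le_iInf fun c => c.2 n x
  

theorem twoSummingNorm_le {T : E →L[𝕜] F} {A : ℝ≥0∞} (hA : A < ∞)
    (h : ∀ (n : ℕ) (x : Fin n → E), strongL2 (fun i => T (x i)) ≤ A * weakL2 𝕜 x) :
    twoSummingNorm T ≤ A := by
  lift A to ℝ≥0 using hA.ne
  exact iInf₂_le A h

theorem twoSummingNorm_add_le {S T : E →L[𝕜] F} (hS : IsTwoSumming S) (hT : IsTwoSumming T) :
    twoSummingNorm (S + T) ≤ twoSummingNorm S + twoSummingNorm T := by
  refine twoSummingNorm_le (ENNReal.add_lt_top.2 ⟨isTwoSumming_iff.1 hS, isTwoSumming_iff.1 hT⟩)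
    fun n x => ?_
  rw [add_mul]
  exact (strongL2_add_le _ _).trans
    (add_le_add (strongL2_le_twoSummingNorm_mul hS x) (strongL2_le_twoSummingNorm_mul hT x))

theorem twoSummingNorm_smul_le (c : 𝕜) {T : E →L[𝕜] F} (hT : IsTwoSumming T) :
    twoSummingNorm (c • T) ≤ ‖c‖ₑ * twoSummingNorm T := by
  refine twoSummingNorm_le (ENNReal.mul_lt_top enorm_lt_top (isTwoSumming_iff.1 hT)) fun n x => ?_
  have := strongL2_smul c (fun i => T (x i))
  simp only [_root_.smul_apply]
  rw [this, mul_assoc]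
  gcongr
  exact strongL2_le_twoSummingNorm_mul hT x

theorem enorm_apply_le_twoSummingNorm {T : E →L[𝕜] F} (hT : IsTwoSumming T) (x : E) :
    ‖T x‖ₑ ≤ twoSummingNorm T * ‖x‖ₑ := by
  have h := strongL2_le_twoSummingNorm_mul hT (fun _ : Fin 1 => x)
  have h' := weakL2_le_strongL2 (𝕜 := 𝕜) (fun _ : Fin 1 => x)
  have e : ∀ {G : Type _} [NormedAddCommGroup G] (y : G), strongL2 (fun _ : Fin 1 => y) = ‖y‖ₑ := by
    intro G _ y
    rw [strongL2_fin, Fin.sum_univ_one, ← ENNReal.rpow_natCast, ← ENNReal.rpow_mul]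
    norm_num
  rw [e] at h
  refine h.trans ?_
  gcongr
  refine h'.trans (le_of_eq ?_)
  rw [strongL2_fin, Fin.sum_univ_one, ← ENNReal.rpow_natCast, ← ENNReal.rpow_mul]
  norm_num

theorem twoSummingNorm_zero : twoSummingNorm (0 : E →L[𝕜] F) = 0 := by
  refine le_antisymm (twoSummingNorm_le ENNReal.zero_lt_top fun n x => ?_) bot_le
  simp [strongL2]

variable (𝕜 E F) in
/-- The linear space of absolutely `2`-summing operators. -/
def twoSummingSubmodule : Submodule 𝕜 (E →L[𝕜] F) where
  carrier := {T | IsTwoSumming T}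
  add_mem' {S T} hS hT := isTwoSumming_iff.2 ((twoSummingNorm_add_le hS hT).trans_lt
    (ENNReal.add_lt_top.2 ⟨isTwoSumming_iff.1 hS, isTwoSumming_iff.1 hT⟩))
  zero_mem' := isTwoSumming_iff.2 (by simp [twoSummingNorm_zero])
  smul_mem' c T hT := isTwoSumming_iff.2 ((twoSummingNorm_smul_le c hT).trans_lt
    (ENNReal.mul_lt_top enorm_lt_top (isTwoSumming_iff.1 hT)))

variable (𝕜 E F) in
/-- The space `P₂(E, F)` of absolutely `2`-summing operators, which carries the `2`-summing norm
(and not the operator norm). -/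
def TwoSumming : Type _ := twoSummingSubmodule 𝕜 E F

namespace TwoSumming

instance : AddCommGroup (TwoSumming 𝕜 E F) := inferInstanceAs (AddCommGroup (twoSummingSubmodule 𝕜 E F))

instance : Module 𝕜 (TwoSumming 𝕜 E F) := inferInstanceAs (Module 𝕜 (twoSummingSubmodule 𝕜 E F))

/-- The inclusion of `P₂(E, F)` into the space of bounded operators. -/
def toCLM : TwoSumming 𝕜 E F →ₗ[𝕜] E →L[𝕜] F := (twoSummingSubmodule 𝕜 E F).subtype

theorem isTwoSumming (T : TwoSumming 𝕜 E F) : IsTwoSumming (toCLM T) := T.2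

instance : Norm (TwoSumming 𝕜 E F) := ⟨fun T => (twoSummingNorm (toCLM T)).toReal⟩

theorem norm_def (T : TwoSumming 𝕜 E F) : ‖T‖ = (twoSummingNorm (toCLM T)).toReal := rfl

theorem core : NormedSpace.Core 𝕜 (TwoSumming 𝕜 E F) where
  norm_nonneg _ := ENNReal.toReal_nonneg
  norm_smul c T := by
    have key : ∀ (c : 𝕜) (T : TwoSumming 𝕜 E F), ‖c • T‖ ≤ ‖c‖ * ‖T‖ := by
      intro c T
      rw [norm_def, norm_def, ← toReal_enorm, ← ENNReal.toReal_mul, map_smul]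
      exact ENNReal.toReal_mono (ENNReal.mul_lt_top enorm_lt_top
        (isTwoSumming_iff.1 T.isTwoSumming)).ne (twoSummingNorm_smul_le c T.isTwoSumming)
    refine le_antisymm (key c T) ?_
    rcases eq_or_ne c 0 with rfl | hc
    · rw [norm_zero, zero_mul]
      exact ENNReal.toReal_nonneg
    · have h := key c⁻¹ (c • T)
      rw [smul_smul, inv_mul_cancel₀ hc, one_smul, norm_inv] at h
      have hc' : 0 < ‖c‖ := norm_pos_iff.2 hc
      calc ‖c‖ * ‖T‖ ≤ ‖c‖ * (‖c‖⁻¹ * ‖c • T‖) := by gcongr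
        _ = ‖c • T‖ := by field_simp
  norm_triangle S T := by
    have hS := (isTwoSumming_iff.1 S.isTwoSumming).ne
    have hT := (isTwoSumming_iff.1 T.isTwoSumming).ne
    rw [norm_def, norm_def, norm_def, ← ENNReal.toReal_add hS hT, map_add]
    exact ENNReal.toReal_mono (ENNReal.add_ne_top.2 ⟨hS, hT⟩)
      (twoSummingNorm_add_le S.isTwoSumming T.isTwoSumming)
  norm_eq_zero_iff T := by
    constructor
    · intro h
      rw [norm_def, ENNReal.toReal_eq_zero_iff] at h
      have h0 := h.resolve_right (isTwoSumming_iff.1 T.isTwoSumming).ne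
      refine Subtype.ext (ContinuousLinearMap.ext fun x => ?_)
      have := enorm_apply_le_twoSummingNorm T.isTwoSumming x
      rw [h0, zero_mul] at this
      exact enorm_eq_zero.1 (le_antisymm this bot_le)
    · rintro rfl
      rw [norm_def, map_zero, twoSummingNorm_zero, ENNReal.toReal_zero]

instance : NormedAddCommGroup (TwoSumming 𝕜 E F) := NormedAddCommGroup.ofCore core

instance instNormedSpace : NormedSpace 𝕜 (TwoSumming 𝕜 E F) := NormedSpace.ofCore core

end TwoSumming

end TwoSummingSpace

/-! ### Between Hilbert spaces the `2`-summing norm is a Hilbert norm -/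

section Hilbert

variable {𝕜 : Type*} [RCLike 𝕜] {H K : Type*}
  [NormedAddCommGroup H] [InnerProductSpace 𝕜 H] [CompleteSpace H]
  [NormedAddCommGroup K] [InnerProductSpace 𝕜 K] [CompleteSpace K]

theorem tsum_enorm_inner_sq {ι : Type*} (b : HilbertBasis ι 𝕜 H) (x : H) :
    ∑' i, ‖inner 𝕜 x (b i)‖ₑ ^ 2 = ‖x‖ₑ ^ 2 := by
  have h := (b.hasSum_inner_mul_inner x x).mapL (RCLike.reCLM (K := 𝕜))
  have h2 : HasSum (fun i => ‖inner 𝕜 x (b i)‖ ^ 2) (‖x‖ ^ 2) := by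
    convert h using 1
    · rfl
    · funext j
      rw [← inner_conj_symm (b j) x, RCLike.mul_conj, ← RCLike.ofReal_pow]
      exact (RCLike.ofReal_re _).symm
    · rw [norm_sq_eq_re_inner (𝕜 := 𝕜)]
      rfl
  have e : ∀ r : ℝ, 0 ≤ r → ENNReal.ofReal (r ^ 2) = ENNReal.ofReal r ^ 2 := fun r hr =>
    ENNReal.ofReal_pow hr 2
  rw [← ofReal_norm, ← e _ (norm_nonneg _), ← h2.tsum_eq,
    ENNReal.ofReal_tsum_of_nonneg (fun _ => by positivity) h2.summable]
  exact tsum_congr fun i => by rw [← ofReal_norm, e _ (norm_nonneg _)]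

theorem twoSummingNorm_sq {ι : Type*} (b : HilbertBasis ι 𝕜 H) {T : H →L[𝕜] K}
    (hT : IsTwoSumming T) : twoSummingNorm T ^ 2 = ∑' i, ‖T (b i)‖ₑ ^ 2 := by
  have lower : ∑' i, ‖T (b i)‖ₑ ^ 2 ≤ twoSummingNorm T ^ 2 := by
    rw [ENNReal.tsum_eq_iSup_sum]
    refine iSup_le fun s => ?_
    set x : Fin s.card → H := fun j => b (s.equivFin.symm j) with hx
    have hw : weakL2 𝕜 x ≤ 1 := by
      refine iSup₂_le fun a ha => ?_
      rw [strongL2_fin]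
      refine ENNReal.rpow_le_one ?_ (by norm_num)
      obtain ⟨v, rfl⟩ := (InnerProductSpace.toDual 𝕜 H).surjective a
      rw [LinearIsometryEquiv.norm_map] at ha
      have : ∑ j, ‖(InnerProductSpace.toDual 𝕜 H v) (x j)‖ₑ ^ 2
          = ∑ i ∈ s, ‖inner 𝕜 v (b i)‖ₑ ^ 2 := by
        rw [← Finset.sum_coe_sort s]
        exact Fintype.sum_equiv s.equivFin.symm _ _ (fun j => by simp [hx])
      rw [this]
      refine (ENNReal.sum_le_tsum s).trans ?_
      rw [tsum_enorm_inner_sq]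
      have : ‖v‖ₑ ≤ 1 := by rw [← ofReal_norm]; exact ENNReal.ofReal_le_one.2 ha
      exact pow_le_one' this 2
    have h := strongL2_le_twoSummingNorm_mul hT x
    have h2 : strongL2 (fun j => T (x j)) ^ 2 = ∑ i ∈ s, ‖T (b i)‖ₑ ^ 2 := by
      rw [strongL2_sq, tsum_fintype, ← Finset.sum_coe_sort s]
      exact Fintype.sum_equiv s.equivFin.symm _ _ (fun j => by simp [hx])
    rw [← h2]
    gcongr
    refine h.trans ?_
    calc twoSummingNorm T * weakL2 𝕜 x ≤ twoSummingNorm T * 1 := by gcongr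
      _ = _ := mul_one _
  refine le_antisymm ?_ lower
  have hfin : ∑' i, ‖T (b i)‖ₑ ^ 2 < ∞ :=
    lower.trans_lt (ENNReal.pow_lt_top (isTwoSumming_iff.1 hT))
  have key : twoSummingNorm T ≤ strongL2 (fun i => T (b i)) := by
    refine twoSummingNorm_le (ENNReal.rpow_lt_top_of_nonneg (by norm_num) hfin.ne) fun n x => ?_
    obtain ⟨w, f, -⟩ := exists_hilbertBasis 𝕜 K
    rw [← ENNReal.pow_le_pow_left_iff two_ne_zero, mul_pow, strongL2_sq, strongL2_sq]
    have hinner : ∀ v : H, ∑ j, ‖inner 𝕜 v (x j)‖ₑ ^ 2 ≤ ‖v‖ₑ ^ 2 * weakL2 𝕜 x ^ 2 := by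
      intro v
      rcases eq_or_ne v 0 with rfl | hv
      · simp
      set u : H := ((‖v‖⁻¹ : ℝ) : 𝕜) • v with hu
      have hv' : ‖v‖ ≠ 0 := norm_ne_zero_iff.2 hv
      have hun : ‖InnerProductSpace.toDual 𝕜 H u‖ ≤ 1 := by
        simp [hu, norm_smul, hv']
      have hb := strongL2_le_weakL2 (𝕜 := 𝕜) x _ hun
      have hvu : v = ((‖v‖ : ℝ) : 𝕜) • u := by
        rw [hu, smul_smul, ← RCLike.ofReal_mul, mul_inv_cancel₀ hv']
        simp
      have : ∀ j, ‖inner 𝕜 v (x j)‖ₑ ^ 2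
          = ‖v‖ₑ ^ 2 * ‖(InnerProductSpace.toDual 𝕜 H u) (x j)‖ₑ ^ 2 := by
        intro j
        rw [← mul_pow]
        congr 1
        conv_lhs => rw [hvu, inner_smul_left, enorm_mul]
        congr 1
        simp [← ofReal_norm]
      simp only [this]
      rw [← Finset.mul_sum]
      gcongr
      rw [← tsum_fintype (L := .unconditional _), ← strongL2_sq]
      gcongr
    have swap : ∀ y : H, ‖T y‖ₑ ^ 2 = ∑' k, ‖inner 𝕜 (T.adjoint (f k)) y‖ₑ ^ 2 := by
      intro y
      rw [← tsum_enorm_inner_sq f]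
      refine tsum_congr fun k => ?_
      rw [ContinuousLinearMap.adjoint_inner_left, ← ofReal_norm, ← ofReal_norm, norm_inner_symm]
    simp only [tsum_fintype, swap]
    rw [← Summable.tsum_finsetSum (fun _ _ => ENNReal.summable), ENNReal.tsum_comm,
      ← ENNReal.tsum_mul_right]
    refine ENNReal.tsum_le_tsum fun k => ?_
    rw [tsum_enorm_inner_sq]
    exact hinner _
  calc twoSummingNorm T ^ 2 ≤ strongL2 (fun i => T (b i)) ^ 2 := by gcongr
    _ = _ := strongL2_sq _

theorem TwoSumming.norm_sq {ι : Type*} (b : HilbertBasis ι 𝕜 H) (T : TwoSumming 𝕜 H K) :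
    HasSum (fun i => ‖toCLM T (b i)‖ ^ 2) (‖T‖ ^ 2) := by
  have h := twoSummingNorm_sq b T.isTwoSumming
  have hfin : ∑' i, ‖toCLM T (b i)‖ₑ ^ 2 ≠ ∞ := by
    rw [← h]
    exact (ENNReal.pow_lt_top (isTwoSumming_iff.1 T.isTwoSumming)).ne
  have := ENNReal.hasSum_toReal hfin
  rw [← ENNReal.tsum_toReal_eq (ENNReal.ne_top_of_tsum_ne_top hfin), ← h, ENNReal.toReal_pow,
    ← TwoSumming.norm_def] at this
  simpa using this

/-- The Hilbert space structure of `P₂(H, K)`: the inner product that induces the `2`-summing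
norm. -/
instance TwoSumming.instInnerProductSpace : InnerProductSpace 𝕜 (TwoSumming 𝕜 H K) :=
  InnerProductSpace.ofNorm 𝕜 fun S T => by
    obtain ⟨w, b, -⟩ := exists_hilbertBasis 𝕜 H
    have h1 := ((S + T).norm_sq b).add ((S - T).norm_sq b)
    have h2 := ((S.norm_sq b).add (T.norm_sq b)).mul_left 2
    simp only [← pow_two]
    refine h1.unique ?_
    convert h2 using 1
    · rfl
    · funext j
      have := parallelogram_law_with_norm 𝕜 (toCLM S (b j)) (toCLM T (b j))
      simpa [pow_two] using this

end Hilbert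

/-! ### The completed tensor products `H ⊗ K` and `E ⊗̃_{g₂} F` -/

section G2

theorem strongL2_append {m n : ℕ} {E : Type*} [NormedAddCommGroup E] (x : Fin m → E)
    (y : Fin n → E) : strongL2 (Fin.append x y) ^ 2 = strongL2 x ^ 2 + strongL2 y ^ 2 := by
  simp [strongL2_sq, tsum_fintype, Fin.sum_univ_add]

theorem weakL2_append {𝕜 : Type*} [RCLike 𝕜] {m n : ℕ} {F : Type*} [NormedAddCommGroup F]
    [NormedSpace 𝕜 F] (x : Fin m → F) (y : Fin n → F) :
    weakL2 𝕜 (Fin.append x y) ^ 2 ≤ weakL2 𝕜 x ^ 2 + weakL2 𝕜 y ^ 2 := by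
  have key : weakL2 𝕜 (Fin.append x y) ≤ (weakL2 𝕜 x ^ 2 + weakL2 𝕜 y ^ 2) ^ (1 / 2 : ℝ) := by
    refine iSup₂_le fun b hb => ?_
    rw [strongL2]
    gcongr
    have h1 := strongL2_le_weakL2 (𝕜 := 𝕜) x b hb
    have h2 := strongL2_le_weakL2 (𝕜 := 𝕜) y b hb
    calc ∑' i, ‖b (Fin.append x y i)‖ₑ ^ 2
        = strongL2 (fun i => b (x i)) ^ 2 + strongL2 (fun i => b (y i)) ^ 2 := by
          simp [strongL2_sq, tsum_fintype, Fin.sum_univ_add]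
      _ ≤ _ := by gcongr
  calc weakL2 𝕜 (Fin.append x y) ^ 2
      ≤ ((weakL2 𝕜 x ^ 2 + weakL2 𝕜 y ^ 2) ^ (1 / 2 : ℝ)) ^ 2 := by gcongr
    _ = weakL2 𝕜 x ^ 2 + weakL2 𝕜 y ^ 2 := by
      rw [← ENNReal.rpow_natCast, ← ENNReal.rpow_mul]
      norm_num

variable {𝕜 : Type} [RCLike 𝕜] {E F : Type*} [NormedAddCommGroup E] [NormedSpace 𝕜 E]
  [NormedAddCommGroup F] [NormedSpace 𝕜 F]

theorem g2_le {n : ℕ} (x : Fin n → E) (y : Fin n → F) :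
    g2 𝕜 E F (∑ i, x i ⊗ₜ[𝕜] y i) ≤ strongL2 x * weakL2 𝕜 y :=
  iInf_le_of_le n <| iInf_le_of_le x <| iInf_le_of_le y <| iInf_le_of_le rfl le_rfl

theorem g2_lt_top (z : E ⊗[𝕜] F) : g2 𝕜 E F z < ∞ := by
  obtain ⟨n, x, y, rfl⟩ := TensorProduct.exists_sum_tmul_eq z
  exact (g2_le x y).trans_lt
    (ENNReal.mul_lt_top (strongL2_fin_lt_top x) (weakL2_fin_lt_top y))

theorem g2_zero : g2 𝕜 E F 0 = 0 := by
  have := g2_le (𝕜 := 𝕜) (E := E) (F := F) (n := 0) Fin.elim0 Fin.elim0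
  simpa [strongL2] using this

theorem g2_smul_le (c : 𝕜) (z : E ⊗[𝕜] F) : g2 𝕜 E F (c • z) ≤ ‖c‖ₑ * g2 𝕜 E F z := by
  rcases eq_or_ne c 0 with rfl | hc
  · simp [g2_zero]
  have hc' : ‖c‖ₑ ≠ 0 := by simpa using hc
  unfold g2
  simp only [ENNReal.mul_iInf_of_ne hc' enorm_ne_top]
  refine le_iInf fun n => le_iInf fun x => le_iInf fun y => le_iInf fun hz => ?_
  rw [← mul_assoc, ← strongL2_smul]
  refine iInf_le_of_le n <| iInf_le_of_le _ <| iInf_le_of_le y <| iInf_le_of_le ?_ le_rfl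
  simp [hz, Finset.smul_sum, TensorProduct.smul_tmul']

/-- A representation can be rescaled so that both factors are balanced. -/
theorem g2_balanced {z : E ⊗[𝕜] F} {A : ℝ≥0} (h : g2 𝕜 E F z < A) :
    ∃ (n : ℕ) (x : Fin n → E) (y : Fin n → F), z = ∑ i, x i ⊗ₜ[𝕜] y i ∧
      strongL2 x ^ 2 ≤ A ∧ weakL2 𝕜 y ^ 2 ≤ A := by
  simp only [g2, iInf_lt_iff] at h
  obtain ⟨n, x, y, hz, h⟩ := h
  have hA : 0 < A := by
    have : (0 : ℝ≥0∞) < A := lt_of_le_of_lt bot_le h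
    exact_mod_cast this
  have triv : z = 0 → ∃ (n : ℕ) (x : Fin n → E) (y : Fin n → F), z = ∑ i, x i ⊗ₜ[𝕜] y i ∧
      strongL2 x ^ 2 ≤ A ∧ weakL2 𝕜 y ^ 2 ≤ A := fun h0 =>
    ⟨0, Fin.elim0, Fin.elim0, by simp [h0], by simp [strongL2], by simp [strongL2, weakL2]⟩
  obtain ⟨s, hs⟩ : ∃ s : ℝ≥0, strongL2 x = s := ⟨_, (ENNReal.coe_toNNReal
    (strongL2_fin_lt_top x).ne).symm⟩
  obtain ⟨t, ht⟩ : ∃ t : ℝ≥0, weakL2 𝕜 y = t := ⟨_, (ENNReal.coe_toNNReal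
    (weakL2_fin_lt_top (𝕜 := 𝕜) y).ne).symm⟩
  rcases eq_or_ne s 0 with rfl | hs0
  · refine triv ?_
    have h0 := strongL2_sq x
    rw [hs] at h0
    have : ∀ i, x i = 0 := by
      have h1 := h0.symm
      simpa [tsum_fintype, Finset.sum_eq_zero_iff] using h1
    simp [hz, this]
  have hst : s * t < A := by
    rw [hs, ht] at h
    exact_mod_cast h
  set r : ℝ≥0 := NNReal.sqrt A / s with hr
  have hA' : NNReal.sqrt A ≠ 0 := by simpa using hA.ne'
  have hr0 : r ≠ 0 := div_ne_zero hA' hs0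
  have hrk : (((r : ℝ) : 𝕜)) ≠ 0 := by simpa using hr0
  have hrn : ‖((r : ℝ) : 𝕜)‖ₑ = (r : ℝ≥0∞) := by simp [← ofReal_norm]
  have hrn' : ‖(((r : ℝ) : 𝕜))⁻¹‖ₑ = ((r⁻¹ : ℝ≥0) : ℝ≥0∞) := by
    rw [enorm_inv hrk, hrn, ENNReal.coe_inv hr0]
  refine ⟨n, fun i => ((r : ℝ) : 𝕜) • x i, fun i => ((r : ℝ) : 𝕜)⁻¹ • y i, ?_, ?_, ?_⟩
  · rw [hz]
    refine Finset.sum_congr rfl fun i _ => ?_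
    rw [TensorProduct.smul_tmul, smul_smul, mul_inv_cancel₀ hrk, one_smul]
  · rw [strongL2_smul, hrn, hs]
    norm_cast
    rw [hr, div_mul_cancel₀ _ hs0, NNReal.sq_sqrt]
  · rw [weakL2_smul, hrn', ht]
    norm_cast
    have : r⁻¹ * t ≤ NNReal.sqrt A := by
      rw [hr, inv_div, div_mul_eq_mul_div]
      refine div_le_of_le_mul₀ (by positivity) (by positivity) ?_
      rw [← pow_two, NNReal.sq_sqrt]
      exact hst.le
    calc (r⁻¹ * t) ^ 2 ≤ NNReal.sqrt A ^ 2 := by gcongr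
      _ = A := NNReal.sq_sqrt A

theorem g2_add_le (z w : E ⊗[𝕜] F) : g2 𝕜 E F (z + w) ≤ g2 𝕜 E F z + g2 𝕜 E F w := by
  have key : ∀ A B : ℝ≥0, g2 𝕜 E F z < A → g2 𝕜 E F w < B → g2 𝕜 E F (z + w) ≤ (A + B : ℝ≥0) := by
    intro A B hA hB
    obtain ⟨m, x, y, hz, hx, hy⟩ := g2_balanced hA
    obtain ⟨n, x', y', hw, hx', hy'⟩ := g2_balanced hB
    have e : z + w = ∑ i, Fin.append x x' i ⊗ₜ[𝕜] Fin.append y y' i := by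
      simp [hz, hw, Fin.sum_univ_add]
    rw [e]
    refine (g2_le _ _).trans ?_
    have h1 : strongL2 (Fin.append x x') ^ 2 ≤ (A + B : ℝ≥0) := by
      rw [strongL2_append]
      push_cast
      gcongr
    have h2 : weakL2 𝕜 (Fin.append y y') ^ 2 ≤ (A + B : ℝ≥0) := by
      refine (weakL2_append y y').trans ?_
      push_cast
      gcongr
    rw [← ENNReal.pow_le_pow_left_iff two_ne_zero, mul_pow, pow_two ((A + B : ℝ≥0) : ℝ≥0∞)]
    gcongr
  refine ENNReal.le_of_forall_pos_le_add fun ε hε _ => ?_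
  obtain ⟨a, ha⟩ : ∃ a : ℝ≥0, g2 𝕜 E F z = a := ⟨_, (ENNReal.coe_toNNReal (g2_lt_top z).ne).symm⟩
  obtain ⟨b, hb⟩ : ∃ b : ℝ≥0, g2 𝕜 E F w = b := ⟨_, (ENNReal.coe_toNNReal (g2_lt_top w).ne).symm⟩
  have hε2 : 0 < ε / 2 := by positivity
  refine (key (a + ε / 2) (b + ε / 2) ?_ ?_).trans ?_
  · rw [ha]
    exact_mod_cast lt_add_of_pos_right a hε2
  · rw [hb]
    exact_mod_cast lt_add_of_pos_right b hε2
  · rw [ha, hb]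
    norm_cast
    rw [add_add_add_comm, add_halves]

variable (𝕜 E F) in
/-- The algebraic tensor product `E ⊗ F`, endowed with `g₂(·; E, F)`. -/
def G2Tensor : Type _ := E ⊗[𝕜] F

namespace G2Tensor

instance : AddCommGroup (G2Tensor 𝕜 E F) := inferInstanceAs (AddCommGroup (E ⊗[𝕜] F))

instance : Module 𝕜 (G2Tensor 𝕜 E F) := inferInstanceAs (Module 𝕜 (E ⊗[𝕜] F))

variable (𝕜 E F) in
/-- The identity, as a map from the algebraic tensor product to `E ⊗ F` with the norm `g₂`. -/
def of : E ⊗[𝕜] F ≃ₗ[𝕜] G2Tensor 𝕜 E F := LinearEquiv.refl 𝕜 _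

instance : Norm (G2Tensor 𝕜 E F) := ⟨fun z => (g2 𝕜 E F ((of 𝕜 E F).symm z)).toReal⟩

theorem norm_def (z : G2Tensor 𝕜 E F) : ‖z‖ = (g2 𝕜 E F ((of 𝕜 E F).symm z)).toReal := rfl

theorem core : SeminormedSpace.Core 𝕜 (G2Tensor 𝕜 E F) where
  norm_nonneg _ := ENNReal.toReal_nonneg
  norm_smul c z := by
    have key : ∀ (c : 𝕜) (z : G2Tensor 𝕜 E F), ‖c • z‖ ≤ ‖c‖ * ‖z‖ := by
      intro c z
      rw [norm_def, norm_def, ← toReal_enorm, ← ENNReal.toReal_mul, map_smul]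
      exact ENNReal.toReal_mono (ENNReal.mul_lt_top enorm_lt_top (g2_lt_top _)).ne
        (g2_smul_le c _)
    refine le_antisymm (key c z) ?_
    rcases eq_or_ne c 0 with rfl | hc
    · rw [norm_zero, zero_mul]
      exact ENNReal.toReal_nonneg
    · have h := key c⁻¹ (c • z)
      rw [smul_smul, inv_mul_cancel₀ hc, one_smul, norm_inv] at h
      have hc' : 0 < ‖c‖ := norm_pos_iff.2 hc
      calc ‖c‖ * ‖z‖ ≤ ‖c‖ * (‖c‖⁻¹ * ‖c • z‖) := by gcongr
        _ = ‖c • z‖ := by field_simp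
  norm_triangle z w := by
    rw [norm_def, norm_def, norm_def, ← ENNReal.toReal_add (g2_lt_top _).ne (g2_lt_top _).ne,
      map_add]
    exact ENNReal.toReal_mono (ENNReal.add_ne_top.2 ⟨(g2_lt_top _).ne, (g2_lt_top _).ne⟩)
      (g2_add_le _ _)

instance : SeminormedAddCommGroup (G2Tensor 𝕜 E F) := SeminormedAddCommGroup.ofCore core

instance instNormedSpace : NormedSpace 𝕜 (G2Tensor 𝕜 E F) where
  norm_smul_le c z := (core.norm_smul c z).le

end G2Tensor

variable (𝕜 E F) in
/-- The completion of `E ⊗ F` with respect to `g₂`. -/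
abbrev G2Completion : Type _ := UniformSpace.Completion (G2Tensor 𝕜 E F)

end G2

section HilbertTensor

variable (𝕜 : Type*) [RCLike 𝕜] (H K : Type*) [NormedAddCommGroup H] [InnerProductSpace 𝕜 H]
  [NormedAddCommGroup K] [InnerProductSpace 𝕜 K]

/-- The Hilbert space tensor product: the completion of the algebraic tensor product with respect
to the inner product `⟪x₁ ⊗ y₁, x₂ ⊗ y₂⟫ = ⟪x₁, x₂⟫ ⟪y₁, y₂⟫`. -/
abbrev HilbertTensor : Type _ := UniformSpace.Completion (H ⊗[𝕜] K)

variable {H K}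

/-- The elementary tensor `x ⊗ y` in the Hilbert space tensor product. -/
abbrev htmul (x : H) (y : K) : HilbertTensor 𝕜 H K := ((x ⊗ₜ[𝕜] y : H ⊗[𝕜] K) : _)

end HilbertTensor

end

universe u v u₁ u₂ v₁ v₂

/-! ### Finite sums of rank-one operators and limits of `2`-summing operators -/

section Summing

variable {𝕜 : Type*} [RCLike 𝕜] {E F : Type*} [NormedAddCommGroup E] [NormedSpace 𝕜 E]
  [NormedAddCommGroup F] [NormedSpace 𝕜 F]

/-! Between Hilbert spaces `P₂` is the Hilbert–Schmidt norm (`twoSummingNorm_sq`), and everything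
else is built on this.

For a Hilbert basis `f` of `K`, an operator expands as `T x = ∑ ⟨x, T* f k⟩ f k`. The family `T* f
k` has strong norm `P₂(T)`, and by Bessel an orthonormal family has weak norm at most 1. Hence the
expansion is a `2`-nuclear representation with `N₂(T) ≤ P₂(T)`, once the countably many nonzero
terms are enumerated. The reverse inequality is Cauchy–Schwarz followed by a limit
(`twoSummingNorm_le_of_hasSum`).

All isometries out of `H ⊗ K` come from one principle (`HilbertTensor.exists_isometryEquiv`): a
bilinear map that multiplies inner products and has total range extends to a unitary. Totality is
checked on rank-one operators, because pairing `T` with `⟨·, u⟩ y` gives `⟨y, T u⟩`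
(`inner_rankOne_left`). The isomorphisms of operator spaces are instances of
`TwoSumming.existsUnique_tensor`, with different unitaries `W` on the target side.

Total accessibility rests on two properties of `g₂`. It respects subspaces in the second variable
(`g2_le_of_antilipschitz`), by an orthogonal projection in the coefficient space `𝕜ⁿ`. It respects
quotients in the first variable, by lifting vectors almost isometrically; with a norming functional
this yields `exists_g2_le_g2_mkQ` when the second factor is finite-dimensional. A general second
factor is reduced to that case by embedding a finite-dimensional subspace almost isometrically into
a finite-dimensional quotient.

On Hilbert spaces, a representation with orthonormal second factors shows that `g₂` is at most the
Hilbert norm, and the bound for `P₂` of a finite-rank operator shows that it is at least that norm.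
The Riesz maps turn trace duality into the inner product, so the Hilbert norm is self-dual and the
dual and adjoint norms agree with it too. -/

theorem sum_enorm_mul_le_strongL2 {ι E₁ E₂ : Type*} [NormedAddCommGroup E₁]
    [NormedAddCommGroup E₂] (s : Finset ι) (c : ι → E₁) (d : ι → E₂) :
    ∑ i ∈ s, ‖c i‖ₑ * ‖d i‖ₑ ≤ (∑ i ∈ s, ‖c i‖ₑ ^ 2) ^ (1 / 2 : ℝ) * strongL2 d := by
  have h := ENNReal.inner_le_Lp_mul_Lq s (fun i => ‖c i‖ₑ) (fun i => ‖d i‖ₑ)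
    (Real.HolderConjugate.two_two)
  simp only [ENNReal.rpow_two] at h
  refine h.trans ?_
  unfold strongL2
  gcongr
  exact ENNReal.sum_le_tsum s

theorem sum_rpow_le_strongL2 {ι E : Type*} [NormedAddCommGroup E] (s : Finset ι) (c : ι → E) :
    (∑ i ∈ s, ‖c i‖ₑ ^ 2) ^ (1 / 2 : ℝ) ≤ strongL2 c := by
  unfold strongL2
  gcongr
  exact ENNReal.sum_le_tsum s

/-- A norming functional turns the vector sum into a scalar one, where Cauchy–Schwarz applies. -/
theorem enorm_sum_smul_le {ι : Type*} (s : Finset ι) (c : ι → 𝕜) (y : ι → F) :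
    ‖∑ i ∈ s, c i • y i‖ₑ ≤ (∑ i ∈ s, ‖c i‖ₑ ^ 2) ^ (1 / 2 : ℝ) * weakL2 𝕜 y := by
  obtain ⟨b, hb, hby⟩ := exists_dual_vector'' 𝕜 (∑ i ∈ s, c i • y i)
  have e : ‖∑ i ∈ s, c i • y i‖ₑ = ‖b (∑ i ∈ s, c i • y i)‖ₑ := by
    rw [hby, ← ofReal_norm, ← ofReal_norm]
    simp
  rw [e, map_sum]
  refine (enorm_sum_le _ _).trans ?_
  simp only [map_smul, smul_eq_mul, enorm_mul]
  refine (sum_enorm_mul_le_strongL2 s c fun i => b (y i)).trans ?_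
  gcongr
  exact strongL2_le_weakL2 y b hb

theorem strongL2_apply_le {ι : Type*} (a : StrongDual 𝕜 E) (x : ι → E) :
    strongL2 (fun i => a (x i)) ≤ ‖a‖ₑ * weakL2 𝕜 x := by
  rcases eq_or_ne a 0 with rfl | ha
  · simp [strongL2]
  have ha' : (‖a‖ : 𝕜) ≠ 0 := by simpa using ha
  have h := strongL2_le_weakL2 (𝕜 := 𝕜) x ((‖a‖ : 𝕜)⁻¹ • a)
    (by rw [norm_smul]; simp [inv_mul_cancel₀ (norm_ne_zero_iff.2 ha)])
  have e : (fun i => a (x i)) = fun i => (‖a‖ : 𝕜) • ((‖a‖ : 𝕜)⁻¹ • a) (x i) := by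
    funext i
    simp [mul_inv_cancel_left₀ ha']
  rw [e, strongL2_smul]
  gcongr
  rw [← ofReal_norm, ← ofReal_norm]
  simp

/-- Cauchy–Schwarz against the `y i` is applied at each `x j`. After exchanging the sums over `i`
and `j`, each `∑ⱼ |a i (x j)|²` is at most `‖a i‖²` times the squared weak norm of `x`. -/
theorem strongL2_sum_smulRight_le {ι κ : Type*} [Finite κ] (s : Finset ι)
    (a : ι → StrongDual 𝕜 E) (y : ι → F) (x : κ → E) :
    strongL2 (fun j => (∑ i ∈ s, (a i).smulRight (y i)) (x j))
      ≤ strongL2 a * weakL2 𝕜 y * weakL2 𝕜 x := by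
  have := Fintype.ofFinite κ
  rw [← ENNReal.pow_le_pow_left_iff two_ne_zero, strongL2_sq, mul_pow, mul_pow, tsum_fintype,
    strongL2_sq a]
  have h1 : ∀ j, ‖(∑ i ∈ s, (a i).smulRight (y i)) (x j)‖ₑ ^ 2
      ≤ (∑' i, ‖a i (x j)‖ₑ ^ 2) * weakL2 𝕜 y ^ 2 := by
    intro j
    have h := (enorm_sum_smul_le s (fun i => a i (x j)) y).trans
      (mul_le_mul_left (sum_rpow_le_strongL2 s _) _)
    calc _ ≤ (strongL2 (fun i => a i (x j)) * weakL2 𝕜 y) ^ 2 := by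
          gcongr
          simpa using h
      _ = _ := by rw [mul_pow, strongL2_sq]
  calc _ ≤ ∑ j, (∑' i, ‖a i (x j)‖ₑ ^ 2) * weakL2 𝕜 y ^ 2 := Finset.sum_le_sum fun j _ => h1 j
    _ = (∑' i, strongL2 (fun j => a i (x j)) ^ 2) * weakL2 𝕜 y ^ 2 := by
      rw [← Finset.sum_mul, ← Summable.tsum_finsetSum fun _ _ => ENNReal.summable]
      simp only [strongL2_sq, tsum_fintype]
    _ ≤ (∑' i, (‖a i‖ₑ * weakL2 𝕜 x) ^ 2) * weakL2 𝕜 y ^ 2 := by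
      gcongr with i
      exact strongL2_apply_le _ _
    _ = _ := by
      simp only [mul_pow, ENNReal.tsum_mul_right]
      ring

theorem continuous_strongL2 {κ : Type*} [Finite κ] :
    Continuous (fun x : κ → E => strongL2 x) := by
  have := Fintype.ofFinite κ
  simp only [strongL2, tsum_fintype]
  refine (ENNReal.continuous_rpow_const).comp ?_
  refine continuous_finsetSum _ fun i _ => ?_
  exact (ENNReal.continuous_pow 2).comp (continuous_enorm.comp (continuous_apply i))

theorem strongL2_le_of_tendsto {α κ : Type*} [Finite κ] {l : Filter α} [l.NeBot] {f : α → κ → F}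
    {g : κ → F} (h : ∀ j, Filter.Tendsto (fun k => f k j) l (nhds (g j))) {A : ℝ≥0∞}
    (hA : ∀ᶠ k in l, strongL2 (f k) ≤ A) : strongL2 g ≤ A :=
  le_of_tendsto ((continuous_strongL2.tendsto g).comp (tendsto_pi_nhds.2 h)) hA

/-- The bound for partial sums survives pointwise limits, since it only tests finitely many vectors.
The arbitrary filter covers sequences, unordered sums and finite sums alike. -/
theorem twoSummingNorm_le_of_hasSum {ι : Type*} {T : E →L[𝕜] F} {a : ι → StrongDual 𝕜 E}
    {y : ι → F} (ha : strongL2 a < ∞) (hy : weakL2 𝕜 y < ∞) {α : Type*} {l : Filter α} [l.NeBot]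
    {s : α → Finset ι}
    (h : ∀ x, Filter.Tendsto (fun k => ∑ i ∈ s k, a i x • y i) l (nhds (T x))) :
    twoSummingNorm T ≤ strongL2 a * weakL2 𝕜 y := by
  refine twoSummingNorm_le (ENNReal.mul_lt_top ha hy) fun n x => ?_
  refine strongL2_le_of_tendsto (l := l) (fun j => h (x j)) (.of_forall fun k => ?_)
  simpa using strongL2_sum_smulRight_le (s k) a y x

theorem twoSummingNorm_le_twoNuclearNorm (T : E →L[𝕜] F) :
    twoSummingNorm T ≤ twoNuclearNorm T := by
  refine le_iInf fun a => le_iInf fun y => le_iInf fun h => ?_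
  refine twoSummingNorm_le_of_hasSum h.strong_lt_top h.weak_lt_top (s := Finset.range)
    (l := Filter.atTop) fun x => ?_
  have := ((ContinuousLinearMap.apply 𝕜 F x).continuous.tendsto T).comp h.tendsto
  simpa [Function.comp_def] using this

theorem IsTwoNuclearRep.twoNuclearNorm_le {T : E →L[𝕜] F} {a : ℕ → StrongDual 𝕜 E} {y : ℕ → F}
    (h : IsTwoNuclearRep T a y) : twoNuclearNorm T ≤ strongL2 a * weakL2 𝕜 y :=
  iInf_le_of_le a <| iInf_le_of_le y <| iInf_le_of_le h le_rfl

theorem IsTwoNuclear.isTwoSumming {T : E →L[𝕜] F} (hT : IsTwoNuclear T) : IsTwoSumming T := by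
  obtain ⟨a, y, h⟩ := hT
  rw [isTwoSumming_iff]
  exact ((twoSummingNorm_le_twoNuclearNorm T).trans h.twoNuclearNorm_le).trans_lt
    (ENNReal.mul_lt_top h.strong_lt_top h.weak_lt_top)

theorem enorm_sum_smulRight_le {ι : Type*} (s : Finset ι) (a : ι → StrongDual 𝕜 E) (y : ι → F) :
    ‖∑ i ∈ s, (a i).smulRight (y i)‖ₑ ≤ (∑ i ∈ s, ‖a i‖ₑ ^ 2) ^ (1 / 2 : ℝ) * weakL2 𝕜 y := by
  refine ContinuousLinearMap.opENorm_le_bound _ fun x => ?_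
  have h := enorm_sum_smul_le s (fun i => a i x) y
  simp only [_root_.sum_apply, ContinuousLinearMap.smulRight_apply]
  refine h.trans ?_
  rw [mul_right_comm]
  gcongr
  calc (∑ i ∈ s, ‖a i x‖ₑ ^ 2) ^ (1 / 2 : ℝ)
      ≤ (∑ i ∈ s, (‖a i‖ₑ * ‖x‖ₑ) ^ 2) ^ (1 / 2 : ℝ) := by
        gcongr with i
        exact (a i).le_opENorm x
    _ = _ := by
      simp only [mul_pow]
      rw [← Finset.sum_mul, ENNReal.mul_rpow_of_nonneg _ _ (by norm_num)]
      congr 1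
      rw [← ENNReal.rpow_natCast, ← ENNReal.rpow_mul]
      norm_num

/-- The operator norm of a finite block is controlled by the square sum of its `‖a i‖`, so the
Cauchy criterion for `∑ ‖a i‖²` passes to the operators. -/
theorem summable_smulRight [CompleteSpace F] {ι : Type*} {a : ι → StrongDual 𝕜 E} {y : ι → F}
    (ha : strongL2 a < ∞) (hy : weakL2 𝕜 y < ∞) :
    Summable fun i => (a i).smulRight (y i) := by
  have hs : Summable fun i => ‖a i‖ ^ 2 := by
    have h : ∑' i, ‖a i‖ₑ ^ 2 ≠ ∞ := by
      rw [← strongL2_sq]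
      exact (ENNReal.pow_lt_top ha).ne
    simpa using ENNReal.summable_toReal h
  set W := (weakL2 𝕜 y).toReal with hW
  have key : ∀ s : Finset ι, ‖∑ i ∈ s, (a i).smulRight (y i)‖ ≤ √(∑ i ∈ s, ‖a i‖ ^ 2) * W := by
    intro s
    have h := ENNReal.toReal_mono (ENNReal.mul_lt_top (ENNReal.rpow_lt_top_of_nonneg (by norm_num)
      (ENNReal.sum_lt_top.2 fun i _ => ENNReal.pow_lt_top enorm_lt_top).ne) hy).ne
      (enorm_sum_smulRight_le s a y)
    rw [ENNReal.toReal_mul, ← ENNReal.toReal_rpow, ENNReal.toReal_sum (fun i _ =>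
      (ENNReal.pow_lt_top enorm_lt_top).ne), ← Real.sqrt_eq_rpow] at h
    simpa using h
  rw [summable_iff_vanishing_norm] at hs ⊢
  intro ε hε
  have hW0 : 0 ≤ W := ENNReal.toReal_nonneg
  -- `W + 1` replaces `W`, which may vanish.
  obtain ⟨s, h⟩ := hs ((ε / (W + 1)) ^ 2) (by positivity)
  refine ⟨s, fun t ht => (key t).trans_lt ?_⟩
  have h1 : √(∑ i ∈ t, ‖a i‖ ^ 2) ≤ ε / (W + 1) := by
    rw [Real.sqrt_le_left (by positivity)]
    exact (le_abs_self _).trans (h t ht).le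
  calc _ ≤ ε / (W + 1) * W := by gcongr
    _ < ε := by
      rw [div_mul_eq_mul_div, div_lt_iff₀ (by positivity)]
      nlinarith

/-- An absolutely `2`-summing operator, as an element of `P₂(E, F)`. -/
def TwoSumming.mk (T : E →L[𝕜] F) (hT : IsTwoSumming T) : TwoSumming 𝕜 E F :=
  (⟨T, hT⟩ : twoSummingSubmodule 𝕜 E F)

@[simp]
theorem TwoSumming.toCLM_mk (T : E →L[𝕜] F) (hT : IsTwoSumming T) : toCLM (mk T hT) = T := rfl

theorem TwoSumming.ext {S T : TwoSumming 𝕜 E F} (h : toCLM S = toCLM T) : S = T := Subtype.ext h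

/-- The operator norm is dominated by `P₂`, which provides the limit operator; lower semicontinuity
of `P₂` under pointwise convergence upgrades the convergence. Completeness is what allows isometries
to be extended from the algebraic tensor product into this space. -/
instance TwoSumming.instCompleteSpace [CompleteSpace F] : CompleteSpace (TwoSumming 𝕜 E F) := by
  refine Metric.complete_of_cauchySeq_tendsto fun u hu => ?_
  have hop : ∀ T : TwoSumming 𝕜 E F, ‖toCLM T‖ ≤ ‖T‖ := fun T => by
    have h : ‖toCLM T‖ₑ ≤ twoSummingNorm (toCLM T) :=
      ContinuousLinearMap.opENorm_le_bound _ (enorm_apply_le_twoSummingNorm T.isTwoSumming)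
    have := ENNReal.toReal_mono (isTwoSumming_iff.1 T.isTwoSumming).ne h
    simpa [norm_def] using this
  have hcauchy : CauchySeq fun n => toCLM (u n) :=
    hu.map ((toCLM (𝕜 := 𝕜) (E := E) (F := F)).mkContinuous 1
      (by simpa using hop)).uniformContinuous
  obtain ⟨T, hT⟩ := cauchySeq_tendsto_of_complete hcauchy
  have hpt : ∀ x, Filter.Tendsto (fun n => toCLM (u n) x) Filter.atTop (nhds (T x)) := fun x =>
    ((ContinuousLinearMap.apply 𝕜 F x).continuous.tendsto T).comp hT
  -- Let `k` tend to infinity in the Cauchy estimate for `u n - u k`, on each finite family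
  -- separately.
  have hbound : ∀ ε : ℝ≥0, 0 < ε → ∃ N, ∀ n ≥ N, twoSummingNorm (toCLM (u n) - T) ≤ ε := by
    intro ε hε
    obtain ⟨N, hN⟩ := Metric.cauchySeq_iff.1 hu ε (by exact_mod_cast hε)
    refine ⟨N, fun n hn => twoSummingNorm_le ENNReal.coe_lt_top fun m x => ?_⟩
    refine strongL2_le_of_tendsto (l := Filter.atTop)
      (f := fun k j => toCLM (u n) (x j) - toCLM (u k) (x j))
      (fun j => tendsto_const_nhds.sub (hpt _)) ?_
    filter_upwards [Filter.eventually_ge_atTop N] with k hk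
    have h := strongL2_le_twoSummingNorm_mul (u n - u k).isTwoSumming x
    have h2 : twoSummingNorm (toCLM (u n - u k)) ≤ ε := by
      have := (hN n hn k hk).le
      rw [dist_eq_norm, norm_def] at this
      exact (ENNReal.le_ofReal_iff_toReal_le (isTwoSumming_iff.1 (u n - u k).isTwoSumming).ne
        ε.2).2 this |>.trans_eq (ENNReal.ofReal_coe_nnreal)
    simp only [map_sub, _root_.sub_apply] at h
    exact h.trans (by gcongr; simpa using h2)
  have hTs : IsTwoSumming T := by
    obtain ⟨N, hN⟩ := hbound 1 one_pos
    have h1 : IsTwoSumming (toCLM (u N) - T) :=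
      isTwoSumming_iff.2 ((hN N le_rfl).trans_lt ENNReal.coe_lt_top)
    have := (twoSummingSubmodule 𝕜 E F).sub_mem (u N).isTwoSumming h1
    rw [sub_sub_cancel] at this
    exact this
  refine ⟨TwoSumming.mk T hTs, ?_⟩
  rw [Metric.tendsto_atTop]
  intro ε hε
  lift ε to ℝ≥0 using hε.le
  have hε' : 0 < ε := by exact_mod_cast hε
  obtain ⟨N, hN⟩ := hbound (ε / 2) (by positivity)
  refine ⟨N, fun n hn => lt_of_le_of_lt ?_ (NNReal.coe_lt_coe.2 (NNReal.half_lt_self hε'.ne'))⟩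
  rw [dist_eq_norm, norm_def, map_sub, TwoSumming.toCLM_mk]
  exact ENNReal.toReal_le_coe_of_le_coe (hN n hn)

end Summing

/-! ### Operators between Hilbert spaces -/

section HilbertSumming

variable {𝕜 : Type*} [RCLike 𝕜] {H K : Type*}
  [NormedAddCommGroup H] [InnerProductSpace 𝕜 H] [CompleteSpace H]
  [NormedAddCommGroup K] [InnerProductSpace 𝕜 K] [CompleteSpace K]

theorem Orthonormal.weakL2_le_one {ι : Type*} {f : ι → K} (hf : Orthonormal 𝕜 f) :
    weakL2 𝕜 f ≤ 1 := by
  refine iSup₂_le fun b hb => ?_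
  obtain ⟨v, rfl⟩ := (InnerProductSpace.toDual 𝕜 K).surjective b
  rw [LinearIsometryEquiv.norm_map] at hb
  refine ENNReal.rpow_le_one ?_ (by norm_num)
  rw [ENNReal.tsum_eq_iSup_sum]
  refine iSup_le fun s => ?_
  have h := (hf.sum_inner_products_le v (s := s)).trans (pow_le_one₀ (norm_nonneg _) hb)
  have := ENNReal.ofReal_le_one.2 h
  rw [ENNReal.ofReal_sum_of_nonneg fun _ _ => by positivity] at this
  refine le_trans (le_of_eq (Finset.sum_congr rfl fun i _ => ?_)) this
  rw [ENNReal.ofReal_pow (norm_nonneg _), ← ofReal_norm, norm_inner_symm]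
  rfl

/-- By Parseval both sides are the sum of the squared moduli of all matrix entries of `T`. -/
theorem tsum_enorm_adjoint_sq {ι κ : Type*} (b : HilbertBasis ι 𝕜 H) (f : HilbertBasis κ 𝕜 K)
    (T : H →L[𝕜] K) : ∑' k, ‖T.adjoint (f k)‖ₑ ^ 2 = ∑' i, ‖T (b i)‖ₑ ^ 2 := by
  simp only [← tsum_enorm_inner_sq b, ← tsum_enorm_inner_sq f]
  rw [ENNReal.tsum_comm]
  refine tsum_congr fun i => tsum_congr fun k => ?_
  rw [ContinuousLinearMap.adjoint_inner_left, ← ofReal_norm, ← ofReal_norm, norm_inner_symm]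

theorem hasSum_adjoint_smul {κ : Type*} (f : HilbertBasis κ 𝕜 K) (T : H →L[𝕜] K) (x : H) :
    HasSum (fun k => InnerProductSpace.toDual 𝕜 H (T.adjoint (f k)) x • f k) (T x) := by
  convert f.hasSum_repr (T x) using 2 with k
  rw [InnerProductSpace.toDual_apply_apply, ContinuousLinearMap.adjoint_inner_left,
    f.repr_apply_apply]

theorem strongL2_toDual_adjoint {ι κ : Type*} (b : HilbertBasis ι 𝕜 H) (f : HilbertBasis κ 𝕜 K)
    (T : H →L[𝕜] K) :
    strongL2 (fun k => InnerProductSpace.toDual 𝕜 H (T.adjoint (f k)))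
      = strongL2 (fun i => T (b i)) := by
  unfold strongL2
  rw [← tsum_enorm_adjoint_sq b f]
  simp only [← ofReal_norm, LinearIsometryEquiv.norm_map]

/-- This is the criterion by which concrete operators are shown to be `2`-summing:
`twoSummingNorm_sq` presupposes that property. -/
theorem isTwoSumming_of_hilbertBasis {ι : Type*} (b : HilbertBasis ι 𝕜 H) {T : H →L[𝕜] K}
    (h : strongL2 (fun i => T (b i)) < ∞) : IsTwoSumming T := by
  obtain ⟨w, f, -⟩ := exists_hilbertBasis 𝕜 K
  have hf := f.orthonormal.weakL2_le_one.trans_lt ENNReal.one_lt_top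
  rw [← strongL2_toDual_adjoint b f] at h
  exact isTwoSumming_iff.2 ((twoSummingNorm_le_of_hasSum h hf (hasSum_adjoint_smul f T)).trans_lt
    (ENNReal.mul_lt_top h hf))

theorem IsTwoSumming.strongL2_eq {ι : Type*} (b : HilbertBasis ι 𝕜 H) {T : H →L[𝕜] K}
    (hT : IsTwoSumming T) : strongL2 (fun i => T (b i)) = twoSummingNorm T := by
  refine (ENNReal.pow_right_strictMono two_ne_zero).injective ?_
  simp only [strongL2_sq, twoSummingNorm_sq b hT]

theorem strongL2_extend {ι E : Type*} [NormedAddCommGroup E] {e : ι → ℕ}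
    (he : Function.Injective e) (a : ι → E) :
    strongL2 (Function.extend e a 0) = strongL2 a := by
  unfold strongL2
  congr 1
  rw [← he.tsum_eq]
  · exact tsum_congr fun i => by rw [he.extend_apply]
  · intro n hn
    by_contra hn'
    exact hn (by simp [Function.extend_apply' _ _ _ hn'])

theorem IsTwoSumming.exists_isTwoNuclearRep {T : H →L[𝕜] K} (hT : IsTwoSumming T) :
    ∃ a y, IsTwoNuclearRep T a y ∧ strongL2 a * weakL2 𝕜 y ≤ twoSummingNorm T := by
  obtain ⟨u, b, -⟩ := exists_hilbertBasis 𝕜 H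
  obtain ⟨w, f, -⟩ := exists_hilbertBasis 𝕜 K
  set a : w → StrongDual 𝕜 H := fun k => InnerProductSpace.toDual 𝕜 H (T.adjoint (f k)) with ha
  have hs : strongL2 a = twoSummingNorm T := by rw [strongL2_toDual_adjoint b f, hT.strongL2_eq b]
  have hfin : strongL2 a < ∞ := hs ▸ isTwoSumming_iff.1 hT
  have hf := f.orthonormal.weakL2_le_one
  have hsum := summable_smulRight hfin (hf.trans_lt ENNReal.one_lt_top)
  -- The series already converges in operator norm; its sum is identified with `T` pointwise.
  have hT' : HasSum (fun k => (a k).smulRight (f k)) T := by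
    convert hsum.hasSum
    ext x
    refine (hasSum_adjoint_smul f T x).unique ?_
    exact hsum.hasSum.mapL (ContinuousLinearMap.apply 𝕜 K x)
  set s : Set w := {k | a k ≠ 0} with hsdef
  -- `K` may be nonseparable, but square summability leaves only countably many nonzero `a k`. These
  -- are placed into `ℕ` by an injection and padded with zeros.
  have hcount : s.Countable := by
    have h : ∑' k, ‖a k‖ₑ ^ 2 ≠ ∞ := by
      rw [← strongL2_sq]
      exact (ENNReal.pow_lt_top hfin).ne
    refine (Summable.countable_support_ennreal h).mono fun k hk => ?_
    rw [Function.mem_support, ← ofReal_norm]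
    exact pow_ne_zero 2 (ENNReal.ofReal_pos.2 (norm_pos_iff.2 hk)).ne'
  have : Countable s := hcount
  obtain ⟨e, he⟩ := exists_injective_nat s
  have hT'' : HasSum (fun k : s => (a k).smulRight (f k)) T := by
    refine (hasSum_subtype_iff_of_support_subset fun k hk => ?_).2 hT'
    intro h0
    exact hk (by ext; simp [h0])
  set a' : ℕ → StrongDual 𝕜 H := Function.extend e (fun k => a k) 0 with ha'
  set y' : ℕ → K := Function.extend e (fun k => f k) 0 with hy'
  have hst : strongL2 a' ≤ twoSummingNorm T := by
    rw [ha', strongL2_extend he, ← hs]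
    unfold strongL2
    gcongr
    exact ENNReal.tsum_comp_le_tsum_of_injective Subtype.val_injective fun k => ‖a k‖ₑ ^ 2
  have hw : weakL2 𝕜 y' ≤ 1 := by
    refine le_trans ?_ (f.orthonormal.comp _ (Subtype.val_injective (p := (· ∈ s)))).weakL2_le_one
    refine iSup₂_le fun c hc => ?_
    have : (fun i => c (y' i)) = Function.extend e (fun k : s => c (f k)) 0 := by
      funext n
      by_cases hn : ∃ k, e k = n
      · obtain ⟨k, rfl⟩ := hn
        simp [hy', he.extend_apply]
      · simp [hy', Function.extend_apply' _ _ _ hn]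
    rw [this, strongL2_extend he]
    exact strongL2_le_weakL2 (𝕜 := 𝕜) (fun k : s => f k) c hc
  refine ⟨a', y', ⟨hst.trans_lt (hs ▸ hfin), hw.trans_lt ENNReal.one_lt_top, ?_⟩, ?_⟩
  · refine HasSum.tendsto_sum_nat ?_
    have h0 : ∀ n ∉ Set.range e, (a' n).smulRight (y' n) = 0 := by
      intro n hn
      rw [ha', Function.extend_apply' _ _ _ hn]
      ext
      simp
    rw [← he.hasSum_iff h0]
    convert hT'' using 2 with k
    simp [ha', hy', he.extend_apply]
  · calc _ ≤ twoSummingNorm T * 1 := by gcongr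
      _ = _ := mul_one _

theorem isTwoSumming_iff_isTwoNuclear (T : H →L[𝕜] K) : IsTwoSumming T ↔ IsTwoNuclear T :=
  ⟨fun hT => by
    obtain ⟨a, y, h, -⟩ := hT.exists_isTwoNuclearRep
    exact ⟨a, y, h⟩, IsTwoNuclear.isTwoSumming⟩

theorem twoSummingNorm_eq_twoNuclearNorm (T : H →L[𝕜] K) :
    twoSummingNorm T = twoNuclearNorm T := by
  refine le_antisymm (twoSummingNorm_le_twoNuclearNorm T) ?_
  by_cases hT : IsTwoSumming T
  · obtain ⟨a, y, h, h'⟩ := hT.exists_isTwoNuclearRep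
    exact h.twoNuclearNorm_le.trans h'
  · rw [isTwoSumming_iff, not_lt, top_le_iff] at hT
    simp [hT]

/-- The inner product was obtained from the norm alone, so its series comes from polarizing the
series for the squared norm. -/
theorem TwoSumming.hasSum_inner {ι : Type*} (b : HilbertBasis ι 𝕜 H) (S T : TwoSumming 𝕜 H K) :
    HasSum (fun i => inner 𝕜 (toCLM S (b i)) (toCLM T (b i))) (inner 𝕜 S T) := by
  have h : ∀ R : TwoSumming 𝕜 H K,
      HasSum (fun i => ((‖toCLM R (b i)‖ : 𝕜)) ^ 2) ((‖R‖ : 𝕜) ^ 2) := fun R => by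
    simpa using (R.norm_sq b).mapL (RCLike.ofRealCLM (K := 𝕜))
  simp only [inner_eq_sum_norm_sq_div_four (𝕜 := 𝕜)]
  have := ((h (S + T)).sub (h (S - T))).add
    (((h (S - (RCLike.I : 𝕜) • T)).sub (h (S + (RCLike.I : 𝕜) • T))).mul_right (RCLike.I : 𝕜))
  simpa using this.div_const 4

end HilbertSumming

/-! ### Isometries out of the Hilbert space tensor product -/

section HilbertTensorIso

variable {𝕜 : Type*} [RCLike 𝕜] {A B X : Type*}
  [NormedAddCommGroup A] [InnerProductSpace 𝕜 A] [NormedAddCommGroup B] [InnerProductSpace 𝕜 B]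

variable (𝕜 A B) in
theorem dense_htmul : Dense (Submodule.span 𝕜 {z : HilbertTensor 𝕜 A B |
    ∃ x y, htmul 𝕜 x y = z} : Set (HilbertTensor 𝕜 A B)) := by
  refine (UniformSpace.Completion.denseRange_coe (α := A ⊗[𝕜] B)).mono ?_
  rintro _ ⟨z, rfl⟩
  induction z with
  | zero => exact Submodule.zero_mem _
  | tmul x y => exact Submodule.subset_span ⟨x, y, rfl⟩
  | add z w hz hw =>
    rw [UniformSpace.Completion.coe_add]
    exact Submodule.add_mem _ hz hw

theorem HilbertTensor.clm_ext [NormedAddCommGroup X] [NormedSpace 𝕜 X]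
    {f g : HilbertTensor 𝕜 A B →L[𝕜] X} (h : ∀ x y, f (htmul 𝕜 x y) = g (htmul 𝕜 x y)) :
    f = g := by
  refine ContinuousLinearMap.ext_on (dense_htmul 𝕜 A B) ?_
  rintro _ ⟨x, y, rfl⟩
  exact h x y

theorem HilbertTensor.isometryEquiv_ext [NormedAddCommGroup X] [NormedSpace 𝕜 X]
    {U V : HilbertTensor 𝕜 A B ≃ₗᵢ[𝕜] X} (h : ∀ x y, U (htmul 𝕜 x y) = V (htmul 𝕜 x y)) :
    U = V := by
  have := clm_ext (f := (U.toContinuousLinearEquiv : HilbertTensor 𝕜 A B →L[𝕜] X))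
    (g := (V.toContinuousLinearEquiv : HilbertTensor 𝕜 A B →L[𝕜] X)) h
  ext z
  exact DFunLike.congr_fun this z

/-- `hβ` makes the linearization of `β` isometric on the algebraic tensor product, and `hd` makes
its range dense, so it extends to a unitary of the completions. -/
theorem HilbertTensor.exists_isometryEquiv [NormedAddCommGroup X] [InnerProductSpace 𝕜 X]
    [CompleteSpace X] (β : A →ₗ[𝕜] B →ₗ[𝕜] X)
    (hβ : ∀ a b a' b', inner 𝕜 (β a b) (β a' b') = inner 𝕜 a a' * inner 𝕜 b b')
    (hd : ∀ v, (∀ a b, inner 𝕜 (β a b) v = 0) → v = 0) :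
    ∃ U : HilbertTensor 𝕜 A B ≃ₗᵢ[𝕜] X, ∀ a b, U (htmul 𝕜 a b) = β a b := by
  have hinner : ∀ z w : A ⊗[𝕜] B,
      inner 𝕜 (TensorProduct.lift β z) (TensorProduct.lift β w) = inner 𝕜 z w := by
    intro z w
    induction z with
    | zero => simp
    | add z z' hz hz' => simp only [map_add, inner_add_left, hz, hz']
    | tmul a b =>
      induction w with
      | zero => simp
      | add w w' hw hw' => simp only [map_add, inner_add_right, hw, hw']
      | tmul a' b' => simp [hβ]
  let e : A ⊗[𝕜] B →ₗ[𝕜] HilbertTensor 𝕜 A B :=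
    (UniformSpace.Completion.toComplₗᵢ (𝕜 := 𝕜) (E := A ⊗[𝕜] B)).toLinearMap
  have he : DenseRange e := UniformSpace.Completion.denseRange_coe
  have hdense : DenseRange (TensorProduct.lift β) := by
    have : Dense ((TensorProduct.lift β).range : Set X) := by
      rw [Submodule.dense_iff_topologicalClosure_eq_top, Submodule.topologicalClosure_eq_top_iff,
        Submodule.eq_bot_iff]
      intro v hv
      refine hd v fun a b => ?_
      have := (Submodule.mem_orthogonal _ v).1 hv (β a b) ⟨a ⊗ₜ b, by simp⟩
      exact this
    rwa [LinearMap.coe_range] at this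
  have hnorm : ∀ z, ‖TensorProduct.lift β (LinearEquiv.refl 𝕜 (A ⊗[𝕜] B) z)‖ = ‖e z‖ := by
    intro z
    exact (((TensorProduct.lift β).isometryOfInner hinner).norm_map z).trans
      (UniformSpace.Completion.norm_coe z).symm
  exact ⟨(LinearEquiv.refl 𝕜 (A ⊗[𝕜] B)).extendOfIsometry e (TensorProduct.lift β) he hdense hnorm,
    fun a b => (LinearEquiv.extendOfIsometry_eq _ _ _ he hdense hnorm (a ⊗ₜ[𝕜] b)).trans (by simp)⟩

theorem inner_htmul (a a' : A) (b b' : B) :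
    inner 𝕜 (htmul 𝕜 a b) (htmul 𝕜 a' b') = inner 𝕜 a a' * inner 𝕜 b b' := by
  rw [UniformSpace.Completion.inner_coe, TensorProduct.inner_tmul]

theorem HilbertTensor.eq_zero_of_inner {v : HilbertTensor 𝕜 A B}
    (h : ∀ a b, inner 𝕜 (htmul 𝕜 a b) v = 0) : v = 0 := by
  have : innerSL 𝕜 v = 0 := clm_ext fun a b => by
    rw [innerSL_apply_apply, ← inner_conj_symm, h]
    simp
  exact inner_self_eq_zero.1 (DFunLike.congr_fun this v)

variable (𝕜 A B) in
/-- The bilinear map `(x, y) ↦ x ⊗ y` into the Hilbert space tensor product. -/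
noncomputable def htmulL : A →L[𝕜] B →L[𝕜] HilbertTensor 𝕜 A B :=
  (ContinuousLinearMap.compL 𝕜 B (A ⊗[𝕜] B) (HilbertTensor 𝕜 A B)
    UniformSpace.Completion.toComplL).comp (TensorProduct.mkL 𝕜 A B)

theorem htmulL_apply (a : A) (b : B) : htmulL 𝕜 A B a b = htmul 𝕜 a b := rfl

theorem htmul_add_left (a a' : A) (b : B) :
    htmul 𝕜 (a + a') b = htmul 𝕜 a b + htmul 𝕜 a' b := by
  simp only [← htmulL_apply, map_add, _root_.add_apply]

theorem htmul_add_right (a : A) (b b' : B) :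
    htmul 𝕜 a (b + b') = htmul 𝕜 a b + htmul 𝕜 a b' := by
  simp only [← htmulL_apply, map_add]

theorem htmul_smul_left (c : 𝕜) (a : A) (b : B) : htmul 𝕜 (c • a) b = c • htmul 𝕜 a b := by
  simp only [← htmulL_apply, map_smul, _root_.smul_apply]

theorem htmul_smul_right (c : 𝕜) (a : A) (b : B) : htmul 𝕜 a (c • b) = c • htmul 𝕜 a b := by
  simp only [← htmulL_apply, map_smul]

theorem HilbertBasis.clm_ext {ι : Type*} (b : HilbertBasis ι 𝕜 A) [NormedAddCommGroup X]
    [NormedSpace 𝕜 X] {f g : A →L[𝕜] X} (h : ∀ i, f (b i) = g (b i)) : f = g := by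
  refine ContinuousLinearMap.ext_on (s := Set.range b) ?_ ?_
  · rw [Submodule.dense_iff_topologicalClosure_eq_top]
    exact b.dense_span
  · rintro _ ⟨i, rfl⟩
    exact h i

theorem orthonormal_htmul {ι κ : Type*} {b : ι → A} {c : κ → B} (hb : Orthonormal 𝕜 b)
    (hc : Orthonormal 𝕜 c) : Orthonormal 𝕜 fun p : ι × κ => htmul 𝕜 (b p.1) (c p.2) := by
  classical
  rw [orthonormal_iff_ite] at hb hc ⊢
  rintro ⟨i, j⟩ ⟨i', j'⟩
  rw [inner_htmul, hb, hc]
  by_cases h : i = i' <;> by_cases h' : j = j' <;> simp [h, h']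

/-- The products of the elements of two Hilbert bases form a Hilbert basis of the Hilbert space
tensor product. -/
noncomputable def HilbertBasis.htensor {ι κ : Type*} (b : HilbertBasis ι 𝕜 A) (c : HilbertBasis κ 𝕜 B) :
    HilbertBasis (ι × κ) 𝕜 (HilbertTensor 𝕜 A B) :=
  HilbertBasis.mkOfOrthogonalEqBot (orthonormal_htmul b.orthonormal c.orthonormal) <| by
    rw [Submodule.eq_bot_iff]
    intro v hv
    -- A vector orthogonal to all `b i ⊗ c j` is freed from the bases one variable at a time, by
    -- continuity.
    have h1 : ∀ i, (innerSL 𝕜 v).comp (htmulL 𝕜 A B (b i)) = 0 := fun i => c.clm_ext fun j => by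
      have := (Submodule.mem_orthogonal _ v).1 hv _ (Submodule.subset_span ⟨(i, j), rfl⟩)
      rw [← inner_conj_symm, map_eq_zero] at this
      simpa [htmulL_apply] using this
    have h2 : ∀ y, (innerSL 𝕜 v).comp ((htmulL 𝕜 A B).flip y) = 0 := fun y =>
      b.clm_ext fun i => by simpa using DFunLike.congr_fun (h1 i) y
    refine HilbertTensor.eq_zero_of_inner fun x y => ?_
    rw [← inner_conj_symm, map_eq_zero]
    exact DFunLike.congr_fun (h2 y) x

@[simp]
theorem HilbertBasis.htensor_apply {ι κ : Type*} (b : HilbertBasis ι 𝕜 A)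
    (c : HilbertBasis κ 𝕜 B) (p : ι × κ) : b.htensor c p = htmul 𝕜 (b p.1) (c p.2) := by
  rw [htensor, HilbertBasis.coe_mkOfOrthogonalEqBot]

end HilbertTensorIso

/-! ### The space of `2`-summing operators as a tensor product -/

namespace TwoSumming

section RankOne

variable {𝕜 : Type*} [RCLike 𝕜] {H K : Type*}
  [NormedAddCommGroup H] [InnerProductSpace 𝕜 H] [CompleteSpace H]
  [NormedAddCommGroup K] [InnerProductSpace 𝕜 K] [CompleteSpace K]

theorem isTwoSumming_rankOne (y : K) (u : H) :
    IsTwoSumming (InnerProductSpace.rankOne 𝕜 y u) := by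
  obtain ⟨w, b, -⟩ := exists_hilbertBasis 𝕜 H
  refine isTwoSumming_of_hilbertBasis b ?_
  have : strongL2 (fun i => InnerProductSpace.rankOne 𝕜 y u (b i)) ^ 2
      = ‖u‖ₑ ^ 2 * ‖y‖ₑ ^ 2 := by
    simp only [strongL2_sq, InnerProductSpace.rankOne_apply, enorm_smul, mul_pow,
      ENNReal.tsum_mul_right, tsum_enorm_inner_sq]
  refine ((ENNReal.pow_lt_top_iff (n := 2)).1 ?_).resolve_right two_ne_zero
  rw [this]
  exact ENNReal.mul_lt_top (ENNReal.pow_lt_top enorm_lt_top) (ENNReal.pow_lt_top enorm_lt_top)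

/-- The rank-one operator `⟨·, u⟩ y`, as an element of `P₂(H, K)`. -/
noncomputable def rankOne (y : K) (u : H) : TwoSumming 𝕜 H K :=
  mk (InnerProductSpace.rankOne 𝕜 y u) (isTwoSumming_rankOne y u)

/-- Expanding `u` in a Hilbert basis collapses the series of the inner product. Rank-one operators
thus read off all matrix entries of `T`, hence are total. -/
theorem inner_rankOne_left (y : K) (u : H) (T : TwoSumming 𝕜 H K) :
    inner 𝕜 (rankOne y u) T = inner 𝕜 y (toCLM T u) := by
  obtain ⟨w, b, -⟩ := exists_hilbertBasis 𝕜 H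
  refine (hasSum_inner b _ T).unique ?_
  have h := ((b.hasSum_repr u).mapL (toCLM T)).mapL (innerSL 𝕜 y)
  convert h using 2 with i
  · simp [rankOne, inner_smul_left, b.repr_apply_apply]
  · rfl

theorem eq_zero_of_inner_rankOne {T : TwoSumming 𝕜 H K}
    (h : ∀ y u, inner 𝕜 (rankOne y u) T = 0) : T = 0 := by
  refine TwoSumming.ext (ContinuousLinearMap.ext fun u => ?_)
  have := h (toCLM T u) u
  rw [inner_rankOne_left, inner_self_eq_zero] at this
  simpa using this

/-- A rank-one operator is conjugate linear in the vector it pairs with. Inserting `J` makes the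
dependence on `x` linear, and the reversed inner product of the conjugate space puts the factor from
`H` in the right order. -/
theorem exists_isometryEquiv_conj :
    ∃! U : HilbertTensor 𝕜 H K ≃ₗᵢ[𝕜] TwoSumming 𝕜 (ConjSpace 𝕜 H) K,
      ∀ (x : H) (y : K), toCLM (U (htmul 𝕜 x y))
        = InnerProductSpace.rankOne 𝕜 y (ConjSpace.J (𝕜 := 𝕜) x) := by
  let β : H →ₗ[𝕜] K →ₗ[𝕜] TwoSumming 𝕜 (ConjSpace 𝕜 H) K :=
    LinearMap.mk₂ 𝕜 (fun x y => rankOne y (ConjSpace.J (𝕜 := 𝕜) x))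
      (fun x x' y => TwoSumming.ext (by simp [rankOne]))
      (fun c x y => TwoSumming.ext (by
        rw [LinearIsometryEquiv.map_smulₛₗ]
        simp [rankOne]))
      (fun x y y' => TwoSumming.ext (by simp [rankOne]))
      (fun c x y => TwoSumming.ext (by simp [rankOne]))
  obtain ⟨U, hU⟩ := HilbertTensor.exists_isometryEquiv β
    (fun a b a' b' => by
      simp only [β, LinearMap.mk₂_apply, inner_rankOne_left]
      simp only [rankOne, toCLM_mk, InnerProductSpace.rankOne_apply, inner_smul_right]
      rfl)
    (fun T hT => eq_zero_of_inner_rankOne fun y u => hT ((ConjSpace.J (𝕜 := 𝕜)).symm u) y)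
  refine ⟨U, fun x y => by rw [hU]; rfl, fun V hV => ?_⟩
  refine HilbertTensor.isometryEquiv_ext fun x y => TwoSumming.ext ?_
  rw [hV, hU]
  rfl

end RankOne

/-! ### Tensor products of `2`-summing operators -/

section Tensor

variable {𝕜 : Type*} [RCLike 𝕜] {H₁ H₂ K₁ K₂ L : Type*}
  [NormedAddCommGroup H₁] [InnerProductSpace 𝕜 H₁] [CompleteSpace H₁]
  [NormedAddCommGroup H₂] [InnerProductSpace 𝕜 H₂] [CompleteSpace H₂]
  [NormedAddCommGroup K₁] [InnerProductSpace 𝕜 K₁] [CompleteSpace K₁]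
  [NormedAddCommGroup K₂] [InnerProductSpace 𝕜 K₂] [CompleteSpace K₂]
  [NormedAddCommGroup L] [InnerProductSpace 𝕜 L] [CompleteSpace L]

/-- The operator `x₁ ⊗ x₂ ↦ W (S x₁ ⊗ T x₂)`. -/
noncomputable def tensorCLM (W : HilbertTensor 𝕜 K₁ K₂ ≃ₗᵢ[𝕜] L) (S : H₁ →L[𝕜] K₁) (T : H₂ →L[𝕜] K₂) :
    HilbertTensor 𝕜 H₁ H₂ →L[𝕜] L :=
  (W.toContinuousLinearEquiv : HilbertTensor 𝕜 K₁ K₂ →L[𝕜] L).comp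
    (TensorProduct.mapL S T).completion

omit [CompleteSpace H₁] [CompleteSpace H₂] [CompleteSpace K₁] [CompleteSpace K₂]
  [CompleteSpace L] in
@[simp]
theorem tensorCLM_htmul (W : HilbertTensor 𝕜 K₁ K₂ ≃ₗᵢ[𝕜] L) (S : H₁ →L[𝕜] K₁)
    (T : H₂ →L[𝕜] K₂) (x : H₁) (y : H₂) :
    tensorCLM W S T (htmul 𝕜 x y) = W (htmul 𝕜 (S x) (T y)) := by
  simp [tensorCLM]

theorem isTwoSumming_tensorCLM (W : HilbertTensor 𝕜 K₁ K₂ ≃ₗᵢ[𝕜] L) {S : H₁ →L[𝕜] K₁}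
    {T : H₂ →L[𝕜] K₂} (hS : IsTwoSumming S) (hT : IsTwoSumming T) :
    IsTwoSumming (tensorCLM W S T) := by
  obtain ⟨w, b, -⟩ := exists_hilbertBasis 𝕜 H₁
  obtain ⟨w', c, -⟩ := exists_hilbertBasis 𝕜 H₂
  refine isTwoSumming_of_hilbertBasis (b.htensor c) ?_
  have : strongL2 (fun p => tensorCLM W S T (b.htensor c p)) ^ 2
      = twoSummingNorm S ^ 2 * twoSummingNorm T ^ 2 := by
    have e : ∀ p, ‖tensorCLM W S T (b.htensor c p)‖ₑ = ‖S (b p.1)‖ₑ * ‖T (c p.2)‖ₑ := fun p => by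
      rw [HilbertBasis.htensor_apply, tensorCLM_htmul, ← ofReal_norm, W.norm_map,
        UniformSpace.Completion.norm_coe, ofReal_norm, TensorProduct.enorm_tmul]
    simp only [strongL2_sq, e, mul_pow, twoSummingNorm_sq b hS, twoSummingNorm_sq c hT]
    rw [ENNReal.tsum_prod (f := fun i j => ‖S (b i)‖ₑ ^ 2 * ‖T (c j)‖ₑ ^ 2)]
    simp only [ENNReal.tsum_mul_left, ENNReal.tsum_mul_right]
  refine ((ENNReal.pow_lt_top_iff (n := 2)).1 ?_).resolve_right two_ne_zero
  rw [this]
  exact ENNReal.mul_lt_top (ENNReal.pow_lt_top (isTwoSumming_iff.1 hS))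
    (ENNReal.pow_lt_top (isTwoSumming_iff.1 hT))

/-- The operator `x₁ ⊗ x₂ ↦ W (S x₁ ⊗ T x₂)`, as an element of `P₂(H₁ ⊗ H₂, L)`. -/
noncomputable def tensor (W : HilbertTensor 𝕜 K₁ K₂ ≃ₗᵢ[𝕜] L) (S : TwoSumming 𝕜 H₁ K₁)
    (T : TwoSumming 𝕜 H₂ K₂) : TwoSumming 𝕜 (HilbertTensor 𝕜 H₁ H₂) L :=
  mk (tensorCLM W (toCLM S) (toCLM T)) (isTwoSumming_tensorCLM W S.isTwoSumming T.isTwoSumming)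

@[simp]
theorem toCLM_tensor_htmul (W : HilbertTensor 𝕜 K₁ K₂ ≃ₗᵢ[𝕜] L) (S : TwoSumming 𝕜 H₁ K₁)
    (T : TwoSumming 𝕜 H₂ K₂) (x : H₁) (y : H₂) :
    toCLM (tensor W S T) (htmul 𝕜 x y) = W (htmul 𝕜 (toCLM S x) (toCLM T y)) :=
  tensorCLM_htmul W _ _ x y

omit [CompleteSpace H₁] [CompleteSpace H₂] [CompleteSpace L] in
theorem ext_htmul {S T : TwoSumming 𝕜 (HilbertTensor 𝕜 H₁ H₂) L}
    (h : ∀ x y, toCLM S (htmul 𝕜 x y) = toCLM T (htmul 𝕜 x y)) : S = T :=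
  TwoSumming.ext (HilbertTensor.clm_ext h)

/-- On a product basis each summand splits into two factors, so the double series is the product of
the two series; `h` supplies the summability. -/
theorem inner_tensor (W : HilbertTensor 𝕜 K₁ K₂ ≃ₗᵢ[𝕜] L) (S S' : TwoSumming 𝕜 H₁ K₁)
    (T T' : TwoSumming 𝕜 H₂ K₂) :
    inner 𝕜 (tensor W S T) (tensor W S' T') = inner 𝕜 S S' * inner 𝕜 T T' := by
  obtain ⟨w, b, -⟩ := exists_hilbertBasis 𝕜 H₁
  obtain ⟨w', c, -⟩ := exists_hilbertBasis 𝕜 H₂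
  have h := hasSum_inner (b.htensor c) (tensor W S T) (tensor W S' T')
  simp only [HilbertBasis.htensor_apply, toCLM_tensor_htmul, LinearIsometryEquiv.inner_map_map,
    inner_htmul] at h
  have hm := (hasSum_inner b S S').mul (hasSum_inner c T T') h.summable
  exact h.unique hm

theorem tensor_rankOne (W : HilbertTensor 𝕜 K₁ K₂ ≃ₗᵢ[𝕜] L) (y₁ : K₁) (y₂ : K₂) (u₁ : H₁)
    (u₂ : H₂) : tensor W (rankOne (𝕜 := 𝕜) y₁ u₁) (rankOne (𝕜 := 𝕜) y₂ u₂)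
      = rankOne (W (htmul 𝕜 y₁ y₂)) (htmul 𝕜 u₁ u₂) := by
  refine ext_htmul fun x y => ?_
  rw [toCLM_tensor_htmul]
  simp only [rankOne, toCLM_mk, InnerProductSpace.rankOne_apply, inner_htmul, ← map_smul]
  congr 1
  rw [htmul_smul_left, htmul_smul_right, smul_smul]

/-- The unitary `W` is kept general so that the direct, swapped and conjugated versions are all
special cases. For totality, tensors of rank-one operators are rank-one, so an `R` orthogonal to
them has `R (x₁ ⊗ x₂)` orthogonal to every `W (y₁ ⊗ y₂)`. -/
theorem existsUnique_tensor (W : HilbertTensor 𝕜 K₁ K₂ ≃ₗᵢ[𝕜] L) :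
    ∃! V : HilbertTensor 𝕜 (TwoSumming 𝕜 H₁ K₁) (TwoSumming 𝕜 H₂ K₂) ≃ₗᵢ[𝕜]
        TwoSumming 𝕜 (HilbertTensor 𝕜 H₁ H₂) L,
      ∀ S T x₁ x₂, toCLM (V (htmul 𝕜 S T)) (htmul 𝕜 x₁ x₂)
        = W (htmul 𝕜 (toCLM S x₁) (toCLM T x₂)) := by
  let β : TwoSumming 𝕜 H₁ K₁ →ₗ[𝕜] TwoSumming 𝕜 H₂ K₂ →ₗ[𝕜]
      TwoSumming 𝕜 (HilbertTensor 𝕜 H₁ H₂) L :=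
    LinearMap.mk₂ 𝕜 (tensor W)
      (fun _ _ _ => ext_htmul fun _ _ => by simp [htmul_add_left])
      (fun _ _ _ => ext_htmul fun _ _ => by simp [htmul_smul_left])
      (fun _ _ _ => ext_htmul fun _ _ => by simp [htmul_add_right])
      (fun _ _ _ => ext_htmul fun _ _ => by simp [htmul_smul_right])
  obtain ⟨V, hV⟩ := HilbertTensor.exists_isometryEquiv β
    (fun S T S' T' => inner_tensor W S S' T T')
    (fun R hR => ext_htmul fun x₁ x₂ => by
      suffices h : W.symm (toCLM R (htmul 𝕜 x₁ x₂)) = 0 by simpa using h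
      refine HilbertTensor.eq_zero_of_inner fun y₁ y₂ => ?_
      have := hR (rankOne y₁ x₁) (rankOne y₂ x₂)
      simp only [β, LinearMap.mk₂_apply, tensor_rankOne, inner_rankOne_left] at this
      rwa [← W.inner_map_map, W.apply_symm_apply])
  refine ⟨V, fun S T x₁ x₂ => ?_, fun V' hV' => ?_⟩
  · rw [hV]
    exact toCLM_tensor_htmul W S T x₁ x₂
  · refine HilbertTensor.isometryEquiv_ext fun S T => ext_htmul fun x₁ x₂ => ?_
    rw [hV', hV]
    exact (toCLM_tensor_htmul W S T x₁ x₂).symm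

end Tensor

end TwoSumming

/-! ### Unitaries on the target side: change of factor, swap, conjugation -/

section Conjugate

variable {𝕜 : Type*} [RCLike 𝕜] {K₁ K₁' K₂ : Type*}
  [NormedAddCommGroup K₁] [InnerProductSpace 𝕜 K₁] [NormedAddCommGroup K₂]
  [InnerProductSpace 𝕜 K₂] [NormedAddCommGroup K₁'] [InnerProductSpace 𝕜 K₁']

theorem HilbertTensor.exists_congr_left (C : K₁' ≃ₗᵢ[𝕜] K₁) :
    ∃ W : HilbertTensor 𝕜 K₁' K₂ ≃ₗᵢ[𝕜] HilbertTensor 𝕜 K₁ K₂,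
      ∀ y₁ y₂, W (htmul 𝕜 y₁ y₂) = htmul 𝕜 (C y₁) y₂ :=
  exists_isometryEquiv
    ((htmulL 𝕜 K₁ K₂).toLinearMap₁₂ ∘ₗ (C.toLinearEquiv : K₁' →ₗ[𝕜] K₁))
    (fun a b a' b' => (inner_htmul _ _ _ _).trans (by simp))
    (fun v hv => eq_zero_of_inner fun a b => by
      simpa [htmulL_apply] using hv (C.symm a) b)

theorem HilbertTensor.exists_comm_congr (C : K₁' ≃ₗᵢ[𝕜] K₁) :
    ∃ W : HilbertTensor 𝕜 K₂ K₁' ≃ₗᵢ[𝕜] HilbertTensor 𝕜 K₁ K₂,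
      ∀ y₂ y₁, W (htmul 𝕜 y₂ y₁) = htmul 𝕜 (C y₁) y₂ :=
  exists_isometryEquiv
    ((htmulL 𝕜 K₁ K₂).toLinearMap₁₂ ∘ₗ (C.toLinearEquiv : K₁' →ₗ[𝕜] K₁)).flip
    (fun a b a' b' => (inner_htmul _ _ _ _).trans (by simp [mul_comm]))
    (fun v hv => eq_zero_of_inner fun a b => by
      simpa [htmulL_apply] using hv b (C.symm a))

/-- `J` carries a Hilbert basis to a Hilbert basis with the same index set; matching coordinates
gives a linear isometry, which depends on the chosen basis. -/
theorem ConjSpace.nonempty_isometryEquiv (K : Type*) [NormedAddCommGroup K]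
    [InnerProductSpace 𝕜 K] [CompleteSpace K] : Nonempty (K ≃ₗᵢ[𝕜] ConjSpace 𝕜 K) := by
  obtain ⟨w, b, -⟩ := exists_hilbertBasis 𝕜 K
  have ho : Orthonormal 𝕜 fun i => ConjSpace.J (𝕜 := 𝕜) (b i) := by
    classical
    have := b.orthonormal
    rw [orthonormal_iff_ite] at this ⊢
    exact fun i j => (this j i).trans (by simp only [eq_comm])
  let c : HilbertBasis w 𝕜 (ConjSpace 𝕜 K) := HilbertBasis.mkOfOrthogonalEqBot ho <| by
    rw [Submodule.eq_bot_iff]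
    intro v hv
    have : innerSL 𝕜 ((ConjSpace.J (𝕜 := 𝕜) (H := K)).symm v) = 0 := b.clm_ext fun i => by
      exact (Submodule.mem_orthogonal _ v).1 hv _ (Submodule.subset_span ⟨i, rfl⟩)
    have h0 : (ConjSpace.J (𝕜 := 𝕜) (H := K)).symm v = 0 :=
      (inner_self_eq_zero (𝕜 := 𝕜)).1 (DFunLike.congr_fun this _)
    simpa using h0
  exact ⟨b.repr.trans c.repr.symm⟩

end Conjugate

/-! ### `g₂` is a tensor norm -/

theorem ENNReal.le_of_forall_one_lt_coe_mul {a b : ℝ≥0∞}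
    (h : ∀ c : ℝ≥0, 1 < c → a ≤ c * b) : a ≤ b := by
  rcases eq_or_ne b ∞ with rfl | hb
  · exact le_top
  have ht : Filter.Tendsto (fun c : ℝ≥0 => (c : ℝ≥0∞) * b) (nhdsWithin 1 (Set.Ioi 1))
      (nhds ((1 : ℝ≥0) * b)) :=
    (ENNReal.Tendsto.mul_const (ENNReal.continuous_coe.tendsto 1) (Or.inr hb)).mono_left
      nhdsWithin_le_nhds
  have := ge_of_tendsto ht (Filter.eventually_of_mem self_mem_nhdsWithin h)
  simpa using this

/-! ### Strong and weak `ℓ₂`-norms under bounded operators -/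

section WeakStrong

variable {𝕜 : Type*} [RCLike 𝕜] {ι E F : Type*} [NormedAddCommGroup E] [NormedSpace 𝕜 E]
  [NormedAddCommGroup F] [NormedSpace 𝕜 F]

theorem strongL2_unique (y : E) : strongL2 (fun _ : Fin 1 => y) = ‖y‖ₑ := by
  rw [strongL2_fin, Fin.sum_univ_one, ← ENNReal.rpow_natCast, ← ENNReal.rpow_mul]
  norm_num

theorem strongL2_le_of_enorm_le {c : ℝ≥0∞} {x : ι → E} {y : ι → F}
    (h : ∀ i, ‖x i‖ₑ ≤ c * ‖y i‖ₑ) : strongL2 x ≤ c * strongL2 y := by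
  rw [← ENNReal.pow_le_pow_left_iff two_ne_zero, mul_pow, strongL2_sq, strongL2_sq,
    ← ENNReal.tsum_mul_left]
  refine ENNReal.tsum_le_tsum fun i => ?_
  rw [← mul_pow]
  gcongr
  exact h i

theorem strongL2_map_le (S : E →L[𝕜] F) (x : ι → E) :
    strongL2 (fun i => S (x i)) ≤ ‖S‖ₑ * strongL2 x :=
  strongL2_le_of_enorm_le fun i => S.le_opENorm (x i)

theorem weakL2_map_le (T : E →L[𝕜] F) (y : ι → E) :
    weakL2 𝕜 (fun i => T (y i)) ≤ ‖T‖ₑ * weakL2 𝕜 y := by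
  refine iSup₂_le fun b hb => ?_
  refine (strongL2_apply_le (b.comp T) y).trans ?_
  gcongr
  rw [← ofReal_norm, ← ofReal_norm]
  refine ENNReal.ofReal_le_ofReal ((b.opNorm_comp_le T).trans ?_)
  exact mul_le_of_le_one_left (norm_nonneg _) hb

/-- A functional in the unit ball of `E'` becomes one of norm at most `C` on the range of `j`, and
Hahn–Banach extends it to `F` with the same norm. -/
theorem weakL2_le_of_antilipschitz {j : E →L[𝕜] F} {C : ℝ≥0} (hj : ∀ y, ‖y‖ ≤ C * ‖j y‖)
    (y : ι → E) : weakL2 𝕜 y ≤ C * weakL2 𝕜 (fun i => j (y i)) := by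
  refine iSup₂_le fun b hb => ?_
  have hinj : Function.Injective (j : E →ₗ[𝕜] F) := by
    rw [injective_iff_map_eq_zero]
    intro v hv
    have := hj v
    rw [show j v = 0 from hv, norm_zero, mul_zero] at this
    exact norm_le_zero_iff.1 this
  let e := LinearEquiv.ofInjective (j : E →ₗ[𝕜] F) hinj
  let b' : StrongDual 𝕜 (LinearMap.range (j : E →ₗ[𝕜] F)) :=
    ((b : E →ₗ[𝕜] 𝕜) ∘ₗ (e.symm : _ →ₗ[𝕜] E)).mkContinuous C fun v => by
      obtain ⟨w, rfl⟩ := e.surjective v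
      have h1 : ‖e w‖ = ‖j w‖ := rfl
      simp only [LinearMap.comp_apply, LinearEquiv.coe_coe, LinearEquiv.symm_apply_apply, h1]
      refine (b.le_opNorm w).trans ((mul_le_of_le_one_left (norm_nonneg _) hb).trans (hj w))
  obtain ⟨c, hc, hcn⟩ := exists_extension_norm_eq _ b'
  have hcC : ‖c‖ₑ ≤ C := by
    rw [← ofReal_norm, hcn, ← ENNReal.ofReal_coe_nnreal]
    exact ENNReal.ofReal_le_ofReal (LinearMap.mkContinuous_norm_le _ C.2 _)
  have e1 : ∀ i, b (y i) = c (j (y i)) := by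
    intro i
    have h1 := hc (e (y i))
    have h2 : b' (e (y i)) = b (y i) := by simp [b']
    rw [← h2, ← h1]
    rfl
  simp only [e1]
  refine (strongL2_apply_le c _).trans ?_
  gcongr

end WeakStrong

section TensorNormG2

variable {𝕜 : Type} [RCLike 𝕜] {E E' F F' : Type*} [NormedAddCommGroup E] [NormedSpace 𝕜 E]
  [NormedAddCommGroup F] [NormedSpace 𝕜 F] [NormedAddCommGroup E'] [NormedSpace 𝕜 E']
  [NormedAddCommGroup F'] [NormedSpace 𝕜 F']

theorem le_mul_g2 {A c : ℝ≥0∞} (hc : c ≠ ∞) {z : E ⊗[𝕜] F}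
    (h : ∀ (n : ℕ) (x : Fin n → E) (y : Fin n → F), z = ∑ i, x i ⊗ₜ[𝕜] y i →
      A ≤ c * (strongL2 x * weakL2 𝕜 y)) : A ≤ c * g2 𝕜 E F z := by
  rcases eq_or_ne c 0 with rfl | hc0
  · obtain ⟨n, x, y, hz⟩ := TensorProduct.exists_sum_tmul_eq z
    simpa using h n x y hz
  · simp only [g2, ENNReal.mul_iInf_of_ne hc0 hc]
    exact le_iInf fun n => le_iInf fun x => le_iInf fun y => le_iInf fun hz => h n x y hz

theorem le_g2 {A : ℝ≥0∞} {z : E ⊗[𝕜] F}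
    (h : ∀ (n : ℕ) (x : Fin n → E) (y : Fin n → F), z = ∑ i, x i ⊗ₜ[𝕜] y i →
      A ≤ strongL2 x * weakL2 𝕜 y) : A ≤ g2 𝕜 E F z :=
  le_iInf fun n => le_iInf fun x => le_iInf fun y => le_iInf fun hz => h n x y hz

theorem g2_map_le (S : E →L[𝕜] E') (T : F →L[𝕜] F') (z : E ⊗[𝕜] F) :
    g2 𝕜 E' F' (TensorProduct.map (S : E →ₗ[𝕜] E') (T : F →ₗ[𝕜] F') z)
      ≤ ‖S‖ₑ * ‖T‖ₑ * g2 𝕜 E F z := by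
  refine le_mul_g2 (ENNReal.mul_lt_top enorm_lt_top enorm_lt_top).ne fun n x y hz => ?_
  have e : TensorProduct.map (S : E →ₗ[𝕜] E') (T : F →ₗ[𝕜] F') z
      = ∑ i, S (x i) ⊗ₜ[𝕜] T (y i) := by simp [hz]
  rw [e, mul_mul_mul_comm]
  refine (g2_le _ _).trans ?_
  gcongr
  · exact strongL2_map_le S x
  · exact weakL2_map_le T y

theorem g2_map_le_of_norm_le_one {S : E →L[𝕜] E'} {T : F →L[𝕜] F'} (hS : ‖S‖ ≤ 1)
    (hT : ‖T‖ ≤ 1) (z : E ⊗[𝕜] F) :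
    g2 𝕜 E' F' (TensorProduct.map (S : E →ₗ[𝕜] E') (T : F →ₗ[𝕜] F') z) ≤ g2 𝕜 E F z := by
  have hS' : ‖S‖ₑ ≤ 1 := by rw [← ofReal_norm]; exact ENNReal.ofReal_le_one.2 hS
  have hT' : ‖T‖ₑ ≤ 1 := by rw [← ofReal_norm]; exact ENNReal.ofReal_le_one.2 hT
  calc _ ≤ ‖S‖ₑ * ‖T‖ₑ * g2 𝕜 E F z := g2_map_le S T z
    _ ≤ 1 * 1 * g2 𝕜 E F z := by gcongr
    _ = _ := by rw [one_mul, one_mul]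

theorem injNorm_le_g2 (z : E ⊗[𝕜] F) : injNorm 𝕜 E F z ≤ g2 𝕜 E F z := by
  refine iSup₂_le fun a ha => iSup₂_le fun b hb => le_g2 fun n x y hz => ?_
  rw [hz, map_sum]
  simp only [TensorProduct.dualDistrib_apply, ContinuousLinearMap.coe_coe]
  refine (enorm_sum_le _ _).trans ?_
  simp only [enorm_mul]
  refine (sum_enorm_mul_le_strongL2 _ (fun i => a (x i)) fun i => b (y i)).trans ?_
  refine mul_le_mul' ?_ (strongL2_le_weakL2 y b hb)
  exact (sum_rpow_le_strongL2 _ _).trans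
    ((strongL2_le_weakL2 x a ha).trans (weakL2_le_strongL2 x))

/-- Functionals on `F` separate points, so `(a ⊗ id) z = 0` for every `a` in the unit ball. The
coordinates of `z` along an algebraic basis of `F` are vectors of `E` killed by all these `a`, hence
zero. -/
theorem eq_zero_of_injNorm_eq_zero {z : E ⊗[𝕜] F} (hz : injNorm 𝕜 E F z = 0) : z = 0 := by
  have h1 : ∀ a : StrongDual 𝕜 E, ‖a‖ ≤ 1 → ∀ b : StrongDual 𝕜 F, ‖b‖ ≤ 1 →
      TensorProduct.dualDistrib 𝕜 E F ((a : E →ₗ[𝕜] 𝕜) ⊗ₜ[𝕜] (b : F →ₗ[𝕜] 𝕜)) z = 0 := by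
    intro a ha b hb
    simp only [injNorm, ENNReal.iSup_eq_zero] at hz
    exact enorm_eq_zero.1 (hz a ha b hb)
  classical
  let s := Module.Basis.ofVectorSpace 𝕜 F
  let c := TensorProduct.equivFinsuppOfBasisRight (M := E) s
  have h2 : ∀ a : StrongDual 𝕜 E, ‖a‖ ≤ 1 →
      TensorProduct.lid 𝕜 F ((a : E →ₗ[𝕜] 𝕜).rTensor F z) = 0 := by
    intro a ha
    obtain ⟨b, hb, hb'⟩ := exists_dual_vector'' 𝕜 (TensorProduct.lid 𝕜 F
      ((a : E →ₗ[𝕜] 𝕜).rTensor F z))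
    have e : ∀ w : E ⊗[𝕜] F, b (TensorProduct.lid 𝕜 F ((a : E →ₗ[𝕜] 𝕜).rTensor F w))
        = TensorProduct.dualDistrib 𝕜 E F ((a : E →ₗ[𝕜] 𝕜) ⊗ₜ[𝕜] (b : F →ₗ[𝕜] 𝕜)) w := by
      intro w
      induction w with
      | zero => simp
      | tmul x y => simp
      | add w w' hw hw' => simp only [map_add, hw, hw']
    rw [e, h1 a ha b hb] at hb'
    exact norm_eq_zero.1 (by exact_mod_cast hb'.symm)
  have h3 : ∀ (a : StrongDual 𝕜 E) (i) (w : E ⊗[𝕜] F),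
      s.repr (TensorProduct.lid 𝕜 F ((a : E →ₗ[𝕜] 𝕜).rTensor F w)) i = a (c w i) := by
    intro a i w
    induction w with
    | zero => simp
    | tmul x y => simp [c, mul_comm]
    | add w w' hw hw' => simp only [map_add, Finsupp.add_apply, hw, hw']
  refine c.map_eq_zero_iff.1 (Finsupp.ext fun i => ?_)
  obtain ⟨a, ha, ha'⟩ := exists_dual_vector'' 𝕜 (c z i)
  rw [← h3, h2 a ha] at ha'
  refine norm_eq_zero.1 ?_
  have : ((0 : 𝕜)) = ‖c z i‖ := by simpa using ha'
  exact_mod_cast this.symm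

theorem g2_smul (c : 𝕜) (z : E ⊗[𝕜] F) : g2 𝕜 E F (c • z) = ‖c‖ₑ * g2 𝕜 E F z := by
  have h := G2Tensor.core.norm_smul c (G2Tensor.of 𝕜 E F z)
  rw [G2Tensor.norm_def, G2Tensor.norm_def, ← toReal_enorm, ← ENNReal.toReal_mul] at h
  exact (ENNReal.toReal_eq_toReal_iff' (g2_lt_top _).ne
    (ENNReal.mul_lt_top enorm_lt_top (g2_lt_top z)).ne).1 h

theorem g2_tmul_le (x : E) (y : F) : g2 𝕜 E F (x ⊗ₜ y) ≤ ‖x‖ₑ * ‖y‖ₑ := by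
  have h := g2_le (𝕜 := 𝕜) (fun _ : Fin 1 => x) (fun _ : Fin 1 => y)
  rw [Fin.sum_univ_one, strongL2_unique] at h
  refine h.trans ?_
  gcongr
  exact (weakL2_le_strongL2 _).trans (strongL2_unique y).le

theorem g2_le_projNorm (z : E ⊗[𝕜] F) : g2 𝕜 E F z ≤ projNorm 𝕜 E F z := by
  refine le_iInf fun n => le_iInf fun x => le_iInf fun y => le_iInf fun hz => ?_
  rw [hz]
  have : ∀ s : Finset (Fin n),
      g2 𝕜 E F (∑ i ∈ s, x i ⊗ₜ y i) ≤ ∑ i ∈ s, ‖x i‖ₑ * ‖y i‖ₑ := by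
    classical
    intro s
    induction s using Finset.induction_on with
    | empty => simp [g2_zero]
    | insert i s hi ih =>
      rw [Finset.sum_insert hi, Finset.sum_insert hi]
      exact (g2_add_le _ _).trans (add_le_add (g2_tmul_le _ _) ih)
  exact this _

theorem isTensorNorm_g2 : IsTensorNorm (g2.{u, v} 𝕜) where
  lt_top _ _ _ _ _ _ z := g2_lt_top z
  add_le _ _ _ _ _ _ z w := g2_add_le z w
  smul_eq _ _ _ _ _ _ c z := g2_smul c z
  eq_zero _ _ _ _ _ _ z hz :=
    eq_zero_of_injNorm_eq_zero (le_antisymm ((injNorm_le_g2 z).trans hz.le) bot_le)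
  inj_le _ _ _ _ _ _ z := injNorm_le_g2 z
  le_proj _ _ _ _ _ _ z := g2_le_projNorm z
  map_le _ _ _ _ _ _ _ _ _ _ _ _ S T z := g2_map_le S T z

/-! ### `g₂` is totally accessible -/

/-- A representation lives in the spans of its own vectors, and by Hahn–Banach the weak norm does
not change on passing to the span. -/
theorem finHull_g2 (z : E ⊗[𝕜] F) : finHull (g2 𝕜) E F z = g2 𝕜 E F z := by
  refine le_antisymm (le_g2 fun n x y hz => ?_) ?_
  · let M := Submodule.span 𝕜 (Set.range x)
    let N := Submodule.span 𝕜 (Set.range y)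
    have hM : FiniteDimensional 𝕜 M := FiniteDimensional.span_of_finite 𝕜 (Set.finite_range x)
    have hN : FiniteDimensional 𝕜 N := FiniteDimensional.span_of_finite 𝕜 (Set.finite_range y)
    let x' : Fin n → M := fun i => ⟨x i, Submodule.subset_span ⟨i, rfl⟩⟩
    let y' : Fin n → N := fun i => ⟨y i, Submodule.subset_span ⟨i, rfl⟩⟩
    have h : finHull (g2 𝕜) E F z ≤ g2 𝕜 M N (∑ i, x' i ⊗ₜ[𝕜] y' i) :=
      iInf₂_le_of_le M hM <| iInf₂_le_of_le N hN <| iInf₂_le_of_le _ (by simp [hz, x', y']) le_rfl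
    refine h.trans ((g2_le _ _).trans (mul_le_mul' le_rfl ?_))
    have := weakL2_le_of_antilipschitz (j := N.subtypeL) (C := 1) (fun y => by simp) y'
    simpa using this
  · refine le_iInf₂ fun M _ => le_iInf₂ fun N _ => le_iInf₂ fun w hw => ?_
    rw [← hw]
    exact g2_map_le_of_norm_le_one M.norm_subtypeL_le N.norm_subtypeL_le w

theorem Submodule.norm_mkQL_le_one (M : Submodule 𝕜 E) [IsClosed (M : Set E)] : ‖M.mkQL‖ ≤ 1 :=
  ContinuousLinearMap.opNorm_le_bound _ zero_le_one fun x => by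
    simpa using Submodule.Quotient.norm_mk_le M x

theorem cofinHull_g2_le (z : E ⊗[𝕜] F) : cofinHull (g2 𝕜) E F z ≤ g2 𝕜 E F z := by
  refine iSup₂_le fun M hM => iSup₂_le fun _ N => iSup₂_le fun hN _ => ?_
  exact g2_map_le_of_norm_le_one M.norm_mkQL_le_one N.norm_mkQL_le_one z

end TensorNormG2

/-! ### Subspaces, quotients and the cofinite hull -/

section TotallyAccessible

theorem LinearMap.exists_comp_eq_of_ker_le {k V W U : Type*} [Field k] [AddCommGroup V]
    [Module k V] [AddCommGroup W] [Module k W] [AddCommGroup U] [Module k U] (f : V →ₗ[k] W)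
    (g : V →ₗ[k] U) (h : f.ker ≤ g.ker) : ∃ r : W →ₗ[k] U, r ∘ₗ f = g := by
  obtain ⟨l, hl⟩ := (f.ker.liftQ f le_rfl).exists_leftInverse_of_injective
    (f.ker.ker_liftQ_eq_bot f le_rfl le_rfl)
  refine ⟨f.ker.liftQ g h ∘ₗ l, LinearMap.ext fun v => ?_⟩
  have := LinearMap.congr_fun hl (f.ker.mkQ v)
  simp only [LinearMap.comp_apply, Submodule.mkQ_apply, Submodule.liftQ_apply,
    LinearMap.id_apply] at this
  simp [this]

variable {𝕜 : Type} [RCLike 𝕜] {E F G : Type*} [NormedAddCommGroup E] [NormedSpace 𝕜 E]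
  [NormedAddCommGroup F] [NormedSpace 𝕜 F] [NormedAddCommGroup G] [NormedSpace 𝕜 G]

theorem strongL2_inner_euclidean {n : ℕ} (v : EuclideanSpace 𝕜 (Fin n)) :
    strongL2 (fun i => inner 𝕜 v (EuclideanSpace.single i (1 : 𝕜))) = ‖v‖ₑ := by
  refine (ENNReal.pow_right_strictMono two_ne_zero).injective ?_
  simp only [strongL2_sq]
  rw [← tsum_enorm_inner_sq (EuclideanSpace.basisFun (Fin n) 𝕜).toHilbertBasis v]
  simp

/-- Compressing a finite family by an orthogonal projection of the coefficient space does not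
increase its weak `ℓ₂`-norm. -/
theorem weakL2_starProjection_le {n : ℕ} (y : Fin n → F)
    (S : Submodule 𝕜 (EuclideanSpace 𝕜 (Fin n))) (u : EuclideanSpace 𝕜 (Fin n) →ₗ[𝕜] F)
    (hu : ∀ i, u (EuclideanSpace.single i 1) = y i) :
    weakL2 𝕜 (fun i => u (S.starProjection (EuclideanSpace.single i 1))) ≤ weakL2 𝕜 y := by
  refine iSup₂_le fun b hb => le_trans ?_ (strongL2_le_weakL2 y b hb)
  let φ : StrongDual 𝕜 (EuclideanSpace 𝕜 (Fin n)) :=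
    LinearMap.toContinuousLinearMap ((b : F →ₗ[𝕜] 𝕜) ∘ₗ u)
  -- The functional `b ∘ u` is represented by `v`, so after compression it is represented by the
  -- projection of `v`, which is no longer than `v`.
  obtain ⟨v, hv⟩ := (InnerProductSpace.toDual 𝕜 _).surjective φ
  have hbu : ∀ w, b (u w) = inner 𝕜 v w := fun w => (DFunLike.congr_fun hv w).symm
  have e1 : (fun i => b (u (S.starProjection (EuclideanSpace.single i 1))))
      = fun i => inner 𝕜 (S.starProjection v) (EuclideanSpace.single i (1 : 𝕜)) := by
    funext i
    rw [hbu, Submodule.inner_starProjection_left_eq_right]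
  have e2 : (fun i => b (y i)) = fun i => inner 𝕜 v (EuclideanSpace.single i (1 : 𝕜)) := by
    funext i
    rw [← hu, hbu]
  rw [e1, e2, strongL2_inner_euclidean, strongL2_inner_euclidean, ← ofReal_norm, ← ofReal_norm]
  exact ENNReal.ofReal_le_ofReal (S.norm_starProjection_apply_le v)

/-- `g₂` respects subspaces in the second variable. -/
theorem g2_le_of_antilipschitz {j : G →L[𝕜] F} {C : ℝ≥0} (hj : ∀ y, ‖y‖ ≤ C * ‖j y‖)
    (z : E ⊗[𝕜] G) : g2 𝕜 E G z ≤ C * g2 𝕜 E F ((j : G →ₗ[𝕜] F).lTensor E z) := by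
  refine le_mul_g2 ENNReal.coe_ne_top fun n x y hz => ?_
  have hinj : Function.Injective (j : G →ₗ[𝕜] F) := by
    rw [injective_iff_map_eq_zero]
    intro v hv
    have := hj v
    rw [show j v = 0 from hv, norm_zero, mul_zero] at this
    exact norm_le_zero_iff.1 this
  let R := LinearMap.range (j : G →ₗ[𝕜] F)
  let u : EuclideanSpace 𝕜 (Fin n) →ₗ[𝕜] F :=
    (EuclideanSpace.basisFun (Fin n) 𝕜).toBasis.constr 𝕜 y
  have hu : ∀ i, u (EuclideanSpace.single i 1) = y i := fun i => by
    have := (EuclideanSpace.basisFun (Fin n) 𝕜).toBasis.constr_basis 𝕜 y i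
    rwa [OrthonormalBasis.coe_toBasis, EuclideanSpace.basisFun_apply] at this
  -- The `y i` need not lie in the range `R` of `j`. They are replaced by `u (P eᵢ)`, where `P`
  -- projects onto the coefficient vectors that `u` sends into `R`.
  let S := (R.mkQ ∘ₗ u).ker
  let P : EuclideanSpace 𝕜 (Fin n) →ₗ[𝕜] EuclideanSpace 𝕜 (Fin n) := S.starProjection
  have hP : ∀ w, P w = S.starProjection w := fun w => rfl
  obtain ⟨r, hr⟩ := LinearMap.exists_comp_eq_of_ker_le (R.mkQ ∘ₗ u) (u - u ∘ₗ P) fun w hw => by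
    have : P w = w := Submodule.starProjection_eq_self_iff.2 hw
    simp [this]
  have hPR : ∀ w, ∃ g, j g = u (P w) := fun w => by
    have h1 : P w ∈ S := S.starProjection_apply_mem w
    have h2 : R.mkQ (u (P w)) = 0 := h1
    rw [Submodule.mkQ_apply, Submodule.Quotient.mk_eq_zero] at h2
    exact h2
  choose g hg using fun i => hPR (EuclideanSpace.single i 1)
  have hq : R.mkQ ∘ₗ (j : G →ₗ[𝕜] F) = 0 := by
    ext v
    simp [R]
  -- The replacement does not change the tensor: `u - u ∘ P` vanishes on `S`, so it factors as `r`
  -- after the quotient map modulo `R`, and that quotient map kills a tensor coming from `E ⊗ G`.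
  have h0 : ∑ i, x i ⊗ₜ[𝕜] (y i - u (P (EuclideanSpace.single i 1))) = 0 := by
    have h1 : (r ∘ₗ R.mkQ).lTensor E (∑ i, x i ⊗ₜ[𝕜] y i) = 0 := by
      rw [← hz, ← LinearMap.lTensor_comp_apply, LinearMap.comp_assoc, hq]
      simp
    rw [← h1, map_sum]
    refine Finset.sum_congr rfl fun i _ => ?_
    have := LinearMap.congr_fun hr (EuclideanSpace.single i 1)
    simp only [LinearMap.comp_apply, LinearMap.sub_apply, hu] at this
    rw [LinearMap.lTensor_tmul, LinearMap.comp_apply, this]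
  have hzg : z = ∑ i, x i ⊗ₜ[𝕜] g i := by
    refine Module.Flat.lTensor_preserves_injective_linearMap (M := E) _ hinj ?_
    simp only [TensorProduct.tmul_sub, Finset.sum_sub_distrib, sub_eq_zero] at h0
    rw [hz, h0]
    simp [hg]
  rw [hzg, mul_left_comm]
  refine (g2_le _ _).trans ?_
  gcongr
  refine (weakL2_le_of_antilipschitz hj g).trans ?_
  gcongr
  simp only [hg]
  exact weakL2_starProjection_le y S u hu

theorem LinearMap.finiteDimensional_quotient_ker {k V W : Type*} [Field k] [AddCommGroup V]
    [Module k V] [AddCommGroup W] [Module k W] [FiniteDimensional k W] (f : V →ₗ[k] W) :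
    FiniteDimensional k (V ⧸ f.ker) :=
  f.quotKerEquivRange.symm.finiteDimensional

/-- `b` is constant on the coset of `y`, whose infimum of norms is the quotient norm. -/
theorem norm_apply_le_norm_mkQ {L : Submodule 𝕜 F} {b : StrongDual 𝕜 F}
    (hb : ‖b‖ ≤ 1) (hL : ∀ l ∈ L, b l = 0) (y : F) : ‖b y‖ ≤ ‖L.mkQ y‖ := by
  refine le_of_forall_pos_le_add fun ε hε => ?_
  obtain ⟨m, hm, hm'⟩ := Submodule.Quotient.norm_mk_lt (L.mkQ y) hε
  have h1 : b m = b y := by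
    have h := hL _ ((Submodule.Quotient.eq L).1 hm)
    rwa [map_sub, sub_eq_zero] at h
  rw [← h1]
  exact ((b.le_opNorm m).trans (mul_le_of_le_one_left (norm_nonneg _) hb)).trans hm'.le

/-- A finite-dimensional subspace embeds almost isometrically into a quotient by a closed
finite-codimensional subspace. -/
theorem exists_isClosed_finiteDimensional_quotient (N : Submodule 𝕜 F) [FiniteDimensional 𝕜 N]
    {C : ℝ≥0} (hC : 1 < C) : ∃ L : Submodule 𝕜 F, IsClosed (L : Set F) ∧
      FiniteDimensional 𝕜 (F ⧸ L) ∧ ∀ y : N, ‖y‖ ≤ C * ‖L.mkQ y‖ := by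
  have hC' : (1 : ℝ) < C := by exact_mod_cast hC
  have hC0 : (0 : ℝ) < C := zero_lt_one.trans hC'
  -- `L` will be the common kernel of norming functionals at a `δ`-net of the unit sphere of `N`. On
  -- that sphere some such functional has modulus at least `1 - δ = C⁻¹`.
  set δ : ℝ := 1 - (C : ℝ)⁻¹ with hδ
  have hδ0 : 0 < δ := sub_pos.2 (inv_lt_one_of_one_lt₀ hC')
  have : ProperSpace N := FiniteDimensional.proper_rclike 𝕜 N
  obtain ⟨t, hts, htf, ht⟩ := (isCompact_sphere (0 : N) 1).finite_cover_balls hδ0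
  choose b hb hb' using fun y : F => exists_dual_vector'' 𝕜 y
  have := htf.fintype
  let ψ : F →L[𝕜] (t → 𝕜) := ContinuousLinearMap.pi fun y => b (y : N)
  refine ⟨LinearMap.ker (ψ : F →ₗ[𝕜] (t → 𝕜)), ψ.isClosed_ker,
    LinearMap.finiteDimensional_quotient_ker _, ?_⟩
  have key : ∀ y : N, ‖y‖ = 1 → 1 ≤ C * ‖(LinearMap.ker (ψ : F →ₗ[𝕜] (t → 𝕜))).mkQ (y : F)‖ := by
    intro y hy
    obtain ⟨y₀, hy₀, hyb⟩ := Set.mem_iUnion₂.1 (ht (mem_sphere_zero_iff_norm.2 hy))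
    have h1 := norm_apply_le_norm_mkQ (L := LinearMap.ker (ψ : F →ₗ[𝕜] (t → 𝕜))) (hb (y₀ : F))
      (fun l hl => congr_fun (LinearMap.mem_ker.1 hl) ⟨y₀, hy₀⟩) (y : F)
    have h2 : ‖b (y₀ : F) (y₀ : F)‖ = 1 := by
      rw [hb']
      simpa using hts hy₀
    have h3 : ‖b (y₀ : F) (y₀ : F)‖ - ‖b (y₀ : F) (y : F)‖ ≤ δ := by
      refine (norm_sub_norm_le _ _).trans ?_
      rw [← map_sub]
      refine ((b _).le_opNorm _).trans ((mul_le_of_le_one_left (norm_nonneg _) (hb _)).trans ?_)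
      rw [norm_sub_rev]
      exact (mem_ball_iff_norm.1 hyb).le
    have h4 : (C : ℝ)⁻¹ ≤ ‖(LinearMap.ker (ψ : F →ₗ[𝕜] (t → 𝕜))).mkQ (y : F)‖ := by
      linarith
    calc (1 : ℝ) = C * (C : ℝ)⁻¹ := (mul_inv_cancel₀ hC0.ne').symm
      _ ≤ _ := by gcongr
  intro y
  rcases eq_or_ne y 0 with rfl | hy
  · simp
  have hy0 : (‖y‖ : 𝕜) ≠ 0 := by simpa using hy
  have hn : ‖(‖y‖ : 𝕜)⁻¹ • y‖ = 1 := by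
    rw [norm_smul]
    simp [hy]
  have h := key _ hn
  rw [Submodule.coe_smul, map_smul, norm_smul, norm_inv, RCLike.norm_ofReal, abs_norm,
    mul_left_comm, inv_mul_eq_div, one_le_div (norm_pos_iff.2 hy)] at h
  exact h

theorem Submodule.Quotient.exists_enorm_le (M : Submodule 𝕜 E) [IsClosed (M : Set E)] {C : ℝ≥0}
    (hC : 1 < C) (x : E ⧸ M) : ∃ m : E, M.mkQ m = x ∧ ‖m‖ₑ ≤ C * ‖x‖ₑ := by
  rcases eq_or_ne x 0 with rfl | hx
  · exact ⟨0, by simp⟩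
  have hC' : (1 : ℝ) < C := by exact_mod_cast hC
  obtain ⟨m, hm, hm'⟩ := Submodule.Quotient.norm_mk_lt x
    (mul_pos (sub_pos.2 hC') (norm_pos_iff.2 hx))
  refine ⟨m, hm, ?_⟩
  rw [← ofReal_norm, ← ofReal_norm, ← ENNReal.ofReal_coe_nnreal, ← ENNReal.ofReal_mul C.coe_nonneg]
  exact ENNReal.ofReal_le_ofReal (by linarith)

/-- A functional norming `z` for `g₂` is a map from `E` into the finite-dimensional dual of `F`,
hence factors through `E ⧸ M` with `M` its kernel. Since `M` does not depend on the lifting constant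
`C`, the inequality holds without loss. -/
theorem exists_g2_le_g2_mkQ [FiniteDimensional 𝕜 F] (z : E ⊗[𝕜] F) :
    ∃ (M : Submodule 𝕜 E) (_ : IsClosed (M : Set E)), FiniteDimensional 𝕜 (E ⧸ M) ∧
      g2 𝕜 E F z ≤ g2 𝕜 (E ⧸ M) F (M.mkQ.rTensor F z) := by
  by_cases h0 : ‖G2Tensor.of 𝕜 E F z‖ = 0
  · refine ⟨⊤, isClosed_univ, inferInstance, ?_⟩
    rw [G2Tensor.norm_def, ENNReal.toReal_eq_zero_iff] at h0
    exact (h0.resolve_right (g2_lt_top _).ne).le.trans bot_le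
  obtain ⟨φ, hφ, hφz⟩ := exists_dual_vector 𝕜 (G2Tensor.of 𝕜 E F z) h0
  let φ' : E ⊗[𝕜] F →ₗ[𝕜] 𝕜 := (φ : G2Tensor 𝕜 E F →ₗ[𝕜] 𝕜) ∘ₗ (G2Tensor.of 𝕜 E F : _ →ₗ[𝕜] _)
  have hφ' : ∀ w, ‖φ' w‖ₑ ≤ g2 𝕜 E F w := fun w => by
    have h := φ.le_opNorm (G2Tensor.of 𝕜 E F w)
    rw [hφ, one_mul, G2Tensor.norm_def] at h
    rw [← ofReal_norm]
    exact (ENNReal.ofReal_le_ofReal h).trans (ENNReal.ofReal_toReal (g2_lt_top _).ne).le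
  have hz : ‖φ' z‖ₑ = g2 𝕜 E F z := by
    rw [← ofReal_norm]
    have h : φ' z = (‖G2Tensor.of 𝕜 E F z‖ : 𝕜) := hφz
    rw [h, RCLike.norm_ofReal, abs_of_nonneg (by rw [G2Tensor.norm_def]; exact ENNReal.toReal_nonneg),
      G2Tensor.norm_def, ENNReal.ofReal_toReal (g2_lt_top _).ne]
    rfl
  let ψ : E →ₗ[𝕜] F →ₗ[𝕜] 𝕜 := TensorProduct.curry φ'
  have hψ : ∀ x y, ψ x y = φ' (x ⊗ₜ y) := fun x y => rfl
  have hclosed : IsClosed (ψ.ker : Set E) := by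
    have e : (ψ.ker : Set E) = ⋂ y, {x | ψ x y = 0} := by
      ext x
      simp [LinearMap.ext_iff]
    rw [e]
    refine isClosed_iInter fun y => ?_
    let f : E →L[𝕜] 𝕜 := (ψ.flip y).mkContinuous ‖y‖ fun x => by
      have h := (hφ' (x ⊗ₜ y)).trans (g2_tmul_le x y)
      rw [← ofReal_norm, ← ofReal_norm, ← ofReal_norm, ← ENNReal.ofReal_mul (norm_nonneg _),
        ENNReal.ofReal_le_ofReal_iff (by positivity), mul_comm] at h
      exact h
    exact isClosed_eq f.continuous continuous_const
  refine ⟨ψ.ker, hclosed, LinearMap.finiteDimensional_quotient_ker ψ, ?_⟩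
  have hfac : ∀ w, φ' w
      = TensorProduct.lift (ψ.ker.liftQ ψ le_rfl) (ψ.ker.mkQ.rTensor F w) := by
    intro w
    induction w with
    | zero => simp
    | tmul x y => simp [hψ]
    | add w w' hw hw' => simp only [map_add, hw, hw']
  refine ENNReal.le_of_forall_one_lt_coe_mul fun C hC => ?_
  refine le_mul_g2 ENNReal.coe_ne_top fun n x y hxy => ?_
  choose m hm hm' using Submodule.Quotient.exists_enorm_le ψ.ker hC
  -- The lifted tensor may differ from `z`, but both have the same image in the quotient, so the
  -- norming functional cannot tell them apart.
  have e : φ' z = φ' (∑ i, m (x i) ⊗ₜ[𝕜] y i) := by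
    rw [hfac, hfac, hxy]
    simp only [map_sum, LinearMap.rTensor_tmul, hm]
  rw [← hz, e, ← mul_assoc]
  refine (hφ' _).trans ((g2_le _ _).trans ?_)
  gcongr
  exact strongL2_le_of_enorm_le fun i => hm' (x i)

theorem g2_le_cofinHull (z : E ⊗[𝕜] F) : g2 𝕜 E F z ≤ cofinHull (g2 𝕜) E F z := by
  refine ENNReal.le_of_forall_one_lt_coe_mul fun C hC => ?_
  obtain ⟨n, x, y, hz⟩ := TensorProduct.exists_sum_tmul_eq z
  -- The quotient by `L` is almost isometric only on this finite-dimensional span, so `z` is first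
  -- regarded as a tensor in `E ⊗ N`.
  let N := Submodule.span 𝕜 (Set.range y)
  have : FiniteDimensional 𝕜 N := FiniteDimensional.span_of_finite 𝕜 (Set.finite_range y)
  let w : E ⊗[𝕜] N := ∑ i, x i ⊗ₜ[𝕜] ⟨y i, Submodule.subset_span ⟨i, rfl⟩⟩
  have hw : N.subtype.lTensor E w = z := by simp [w, hz]
  obtain ⟨L, hL, hL', hNL⟩ := exists_isClosed_finiteDimensional_quotient N hC
  obtain ⟨M, hM, hM', hMz⟩ := exists_g2_le_g2_mkQ (L.mkQ.lTensor E z)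
  have h1 : g2 𝕜 E F z ≤ g2 𝕜 E N w := by
    rw [← hw]
    exact g2_map_le_of_norm_le_one (S := .id 𝕜 E) ContinuousLinearMap.norm_id_le
      N.norm_subtypeL_le w
  have h2 : g2 𝕜 E N w ≤ C * g2 𝕜 E (F ⧸ L) (L.mkQ.lTensor E z) := by
    have := g2_le_of_antilipschitz (j := L.mkQL.comp N.subtypeL) hNL w
    rw [← hw, ← LinearMap.lTensor_comp_apply]
    exact this
  have h3 : M.mkQ.rTensor (F ⧸ L) (L.mkQ.lTensor E z) = TensorProduct.map M.mkQ L.mkQ z := by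
    rw [← LinearMap.comp_apply, LinearMap.rTensor_comp_lTensor]
  have h4 : g2 𝕜 (E ⧸ M) (F ⧸ L) (TensorProduct.map M.mkQ L.mkQ z) ≤ cofinHull (g2 𝕜) E F z :=
    le_iSup₂_of_le M hM <| le_iSup₂_of_le hM' L <| le_iSup₂_of_le hL hL' le_rfl
  calc _ ≤ C * g2 𝕜 E (F ⧸ L) (L.mkQ.lTensor E z) := h1.trans h2
    _ ≤ C * cofinHull (g2 𝕜) E F z := by
      gcongr
      exact (hMz.trans_eq (by rw [h3])).trans h4

theorem isTotallyAccessible_g2 : IsTotallyAccessible (g2.{u, v} 𝕜) :=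
  fun _ _ _ _ _ _ z =>
    (finHull_g2 z).trans (le_antisymm (g2_le_cofinHull z) (cofinHull_g2_le z))

end TotallyAccessible

/-! ### `g₂` and its duals on Hilbert spaces -/

section HilbertG2

variable {𝕜 : Type} [RCLike 𝕜] {H K : Type*} [NormedAddCommGroup H] [InnerProductSpace 𝕜 H]
  [NormedAddCommGroup K] [InnerProductSpace 𝕜 K]

/-- The Hilbert norm of the tensor is `P₂` of the corresponding finite-rank operator on the
conjugate space, which is bounded by strong times weak norm. -/
theorem enorm_sum_tmul_le [CompleteSpace H] [CompleteSpace K] {n : ℕ} (x : Fin n → H)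
    (y : Fin n → K) : ‖∑ i, x i ⊗ₜ[𝕜] y i‖ₑ ≤ strongL2 x * weakL2 𝕜 y := by
  obtain ⟨U, hU, -⟩ := TwoSumming.exists_isometryEquiv_conj (𝕜 := 𝕜) (H := H) (K := K)
  let a : Fin n → StrongDual 𝕜 (ConjSpace 𝕜 H) := fun i =>
    InnerProductSpace.toDual 𝕜 _ (ConjSpace.J (𝕜 := 𝕜) (x i))
  have ha : strongL2 a = strongL2 x := by
    unfold strongL2
    simp only [a, ← ofReal_norm, LinearIsometryEquiv.norm_map]
  have hUz : TwoSumming.toCLM (U ((∑ i, x i ⊗ₜ[𝕜] y i : H ⊗[𝕜] K) : HilbertTensor 𝕜 H K))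
      = ∑ i, (a i).smulRight (y i) := by
    rw [← UniformSpace.Completion.coe_toComplL (𝕜 := 𝕜), map_sum, map_sum, map_sum]
    exact Finset.sum_congr rfl fun i _ => hU (x i) (y i)
  -- A finite sum is treated as the limit of a constant sequence.
  have h := twoSummingNorm_le_of_hasSum (ι := Fin n) (T := ∑ i, (a i).smulRight (y i)) (a := a)
    (strongL2_fin_lt_top a) (weakL2_fin_lt_top (𝕜 := 𝕜) y) (l := Filter.atTop (α := ℕ))
    (s := fun _ => Finset.univ) fun v => by simp
  rw [← ha, ← ofReal_norm, ← UniformSpace.Completion.norm_coe, ← U.norm_map,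
    TwoSumming.norm_def, hUz]
  exact ENNReal.ofReal_toReal_le.trans h

/-- The second factors are expanded in an orthonormal basis of their span. Such representations are
optimal for `g₂`. -/
theorem exists_orthonormal_rep (z : H ⊗[𝕜] K) : ∃ (n : ℕ) (x : Fin n → H) (f : Fin n → K),
    Orthonormal 𝕜 f ∧ z = ∑ i, x i ⊗ₜ[𝕜] f i := by
  obtain ⟨m, x, y, hz⟩ := TensorProduct.exists_sum_tmul_eq z
  let N := Submodule.span 𝕜 (Set.range y)
  have : FiniteDimensional 𝕜 N := FiniteDimensional.span_of_finite 𝕜 (Set.finite_range y)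
  let e := stdOrthonormalBasis 𝕜 N
  let y' : Fin m → N := fun i => ⟨y i, Submodule.subset_span ⟨i, rfl⟩⟩
  refine ⟨_, fun k => ∑ i, e.repr (y' i) k • x i, fun k => (e k : K),
    e.orthonormal.comp_linearIsometry N.subtypeₗᵢ, ?_⟩
  have hy : ∀ i, y i = ∑ k, e.repr (y' i) k • (e k : K) := fun i => by
    have := congrArg N.subtype (e.sum_repr (y' i))
    simpa [y'] using this.symm
  rw [hz]
  simp only [TensorProduct.sum_tmul, TensorProduct.smul_tmul]
  rw [Finset.sum_comm]
  refine Finset.sum_congr rfl fun i _ => ?_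
  conv_lhs => rw [hy i, TensorProduct.tmul_sum]

theorem enorm_sum_tmul_orthonormal {n : ℕ} (x : Fin n → H) {f : Fin n → K}
    (hf : Orthonormal 𝕜 f) : ‖∑ i, x i ⊗ₜ[𝕜] f i‖ₑ = strongL2 x := by
  classical
  rw [orthonormal_iff_ite] at hf
  have h : ‖∑ i, x i ⊗ₜ[𝕜] f i‖ ^ 2 = ∑ i, ‖x i‖ ^ 2 := by
    have hi : inner 𝕜 (∑ i, x i ⊗ₜ[𝕜] f i) (∑ i, x i ⊗ₜ[𝕜] f i)
        = ((∑ i, ‖x i‖ ^ 2 : ℝ) : 𝕜) := by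
      rw [sum_inner]
      simp only [inner_sum, TensorProduct.inner_tmul, hf, mul_ite, mul_one, mul_zero,
        Finset.sum_ite_eq, Finset.mem_univ, if_true, inner_self_eq_norm_sq_to_K]
      push_cast
      rfl
    rw [norm_sq_eq_re_inner (𝕜 := 𝕜), hi, RCLike.ofReal_re]
  refine (ENNReal.pow_right_strictMono two_ne_zero).injective ?_
  simp only [strongL2_sq, tsum_fintype, ← ofReal_norm]
  rw [← ENNReal.ofReal_pow (norm_nonneg _), h, ENNReal.ofReal_sum_of_nonneg fun _ _ => by positivity]
  exact Finset.sum_congr rfl fun i _ => ENNReal.ofReal_pow (norm_nonneg _) 2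

theorem g2_eq_enorm [CompleteSpace H] [CompleteSpace K] (z : H ⊗[𝕜] K) :
    g2 𝕜 H K z = ‖z‖ₑ := by
  refine le_antisymm ?_ (le_g2 fun n x y hz => hz ▸ enorm_sum_tmul_le x y)
  obtain ⟨n, x, f, hf, rfl⟩ := exists_orthonormal_rep z
  rw [enorm_sum_tmul_orthonormal x hf]
  calc _ ≤ strongL2 x * weakL2 𝕜 f := g2_le x f
    _ ≤ strongL2 x * 1 := by
      gcongr
      exact hf.weakL2_le_one
    _ = _ := mul_one _

theorem weakL2_toDual [CompleteSpace K] {ι : Type*} (v : ι → K) :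
    weakL2 𝕜 (fun i => InnerProductSpace.toDual 𝕜 K (v i)) = weakL2 𝕜 v := by
  have key : ∀ p : K, ‖p‖ ≤ 1 →
      strongL2 (fun i => inner 𝕜 (v i) p) ≤ weakL2 𝕜 v := by
    intro p hp
    refine le_trans (le_of_eq ?_) (strongL2_le_weakL2 v (InnerProductSpace.toDual 𝕜 K p)
      (by rwa [LinearIsometryEquiv.norm_map]))
    unfold strongL2
    simp only [← ofReal_norm, InnerProductSpace.toDual_apply_apply, norm_inner_symm p]
  refine le_antisymm (iSup₂_le fun Φ hΦ => ?_) (iSup₂_le fun b hb => ?_)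
  -- The Riesz map is conjugate linear. Precomposing with the inverse of `J` makes `Φ` a linear
  -- functional on the conjugate space, where Riesz yields `q`.
  · let Ψ : ConjSpace 𝕜 K →L[𝕜] 𝕜 := Φ.comp
      (((ConjSpace.J (𝕜 := 𝕜) (H := K)).symm.trans (InnerProductSpace.toDual 𝕜 K)).toContinuousLinearEquiv : ConjSpace 𝕜 K →L[𝕜] StrongDual 𝕜 K)
    obtain ⟨q, hq⟩ := (InnerProductSpace.toDual 𝕜 (ConjSpace 𝕜 K)).surjective Ψ
    have hqn : ‖q‖ ≤ 1 := by
      rw [← (InnerProductSpace.toDual 𝕜 (ConjSpace 𝕜 K)).norm_map, hq]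
      refine ContinuousLinearMap.opNorm_le_bound _ zero_le_one fun x => ?_
      refine (Φ.le_opNorm _).trans ?_
      gcongr
      exact (LinearIsometryEquiv.norm_map _ x).le
    have e : ∀ i, Φ (InnerProductSpace.toDual 𝕜 K (v i))
        = inner 𝕜 (v i) ((ConjSpace.J (𝕜 := 𝕜) (H := K)).symm q) := fun i =>
      (DFunLike.congr_fun hq (ConjSpace.J (𝕜 := 𝕜) (v i))).symm
    simp only [e]
    exact key _ ((LinearIsometryEquiv.norm_map _ q).trans_le hqn)
  · obtain ⟨p, rfl⟩ := (InnerProductSpace.toDual 𝕜 K).surjective b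
    rw [LinearIsometryEquiv.norm_map] at hb
    refine le_trans (le_of_eq ?_) (strongL2_le_weakL2 _ (NormedSpace.inclusionInDoubleDual 𝕜 K p)
      ((NormedSpace.double_dual_bound 𝕜 K p).trans hb))
    unfold strongL2
    simp only [← ofReal_norm, InnerProductSpace.toDual_apply_apply, norm_inner_symm p,
      NormedSpace.dual_def]

theorem dualDistrib_toDual [CompleteSpace H] [CompleteSpace K] {n : ℕ} (u : Fin n → H)
    (v : Fin n → K) (z : H ⊗[𝕜] K) :
    TensorProduct.dualDistrib 𝕜 H K (TensorProduct.map (ContinuousLinearMap.coeLM 𝕜)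
      (ContinuousLinearMap.coeLM 𝕜) (∑ i, InnerProductSpace.toDual 𝕜 H (u i) ⊗ₜ[𝕜]
        InnerProductSpace.toDual 𝕜 K (v i))) z = inner 𝕜 (∑ i, u i ⊗ₜ[𝕜] v i) z := by
  induction z with
  | zero => simp
  | tmul x y => simp [sum_inner]
  | add z z' hz hz' => simp only [map_add, inner_add_right, hz, hz']

/-- Through the Riesz maps the pairing is the inner product of `H ⊗ K`, so one inequality is
Cauchy–Schwarz and the other is tested on `z / ‖z‖`. -/
theorem traceDualNorm_g2 [CompleteSpace H] [CompleteSpace K] (z : H ⊗[𝕜] K) :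
    traceDualNorm (g2 𝕜) H K z = ‖z‖ₑ := by
  have hs : ∀ {n : ℕ} (u : Fin n → H),
      strongL2 (fun i => InnerProductSpace.toDual 𝕜 H (u i)) = strongL2 u := by
    intro n u
    unfold strongL2
    simp only [← ofReal_norm, LinearIsometryEquiv.norm_map]
  refine le_antisymm (iSup₂_le fun φ hφ => ?_) ?_
  · have h : ‖TensorProduct.dualDistrib 𝕜 H K (TensorProduct.map (ContinuousLinearMap.coeLM 𝕜)
        (ContinuousLinearMap.coeLM 𝕜) φ) z‖ₑ ≤ ‖z‖ₑ * g2 𝕜 _ _ φ := by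
      refine le_mul_g2 enorm_ne_top fun n a b hab => ?_
      choose u hu using fun i => (InnerProductSpace.toDual 𝕜 H).surjective (a i)
      choose v hv using fun i => (InnerProductSpace.toDual 𝕜 K).surjective (b i)
      obtain rfl : (fun i => InnerProductSpace.toDual 𝕜 H (u i)) = a := funext hu
      obtain rfl : (fun i => InnerProductSpace.toDual 𝕜 K (v i)) = b := funext hv
      rw [hab, dualDistrib_toDual, weakL2_toDual, hs, mul_comm]
      calc _ ≤ ‖∑ i, u i ⊗ₜ[𝕜] v i‖ₑ * ‖z‖ₑ := by
            rw [← ofReal_norm, ← ofReal_norm, ← ofReal_norm, ← ENNReal.ofReal_mul (norm_nonneg _)]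
            exact ENNReal.ofReal_le_ofReal (norm_inner_le_norm _ _)
        _ ≤ _ := by
          gcongr
          exact enorm_sum_tmul_le u v
    calc _ ≤ ‖z‖ₑ * g2 𝕜 _ _ φ := h
      _ ≤ ‖z‖ₑ * 1 := by gcongr
      _ = _ := mul_one _
  · rcases eq_or_ne z 0 with rfl | hz
    · simp
    obtain ⟨n, x, f, hf, hzf⟩ := exists_orthonormal_rep z
    have hz0 : ‖z‖ ≠ 0 := norm_ne_zero_iff.2 hz
    let φ := (‖z‖ : 𝕜)⁻¹ • ∑ i, InnerProductSpace.toDual 𝕜 H (x i) ⊗ₜ[𝕜]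
        InnerProductSpace.toDual 𝕜 K (f i)
    have hn : ‖(‖z‖ : 𝕜)⁻¹‖ₑ = ‖z‖ₑ⁻¹ := by
      rw [enorm_inv (by simpa using hz)]
      congr 1
      rw [← ofReal_norm, ← ofReal_norm]
      simp
    have hz1 : ‖z‖ₑ⁻¹ * ‖z‖ₑ = 1 := ENNReal.inv_mul_cancel (by simpa using hz) enorm_ne_top
    have hφ : g2 𝕜 _ _ φ ≤ 1 := by
      rw [g2_smul, hn, ← hz1]
      gcongr
      refine (g2_le _ _).trans ?_
      rw [hs, weakL2_toDual, hzf, enorm_sum_tmul_orthonormal x hf]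
      exact mul_le_of_le_one_right' hf.weakL2_le_one
    refine le_trans (le_of_eq ?_) (le_iSup₂ (f := fun φ (_ : g2 𝕜 _ _ φ ≤ 1) =>
      ‖TensorProduct.dualDistrib 𝕜 H K (TensorProduct.map (ContinuousLinearMap.coeLM 𝕜)
        (ContinuousLinearMap.coeLM 𝕜) φ) z‖ₑ) φ hφ)
    simp only [φ, map_smul, LinearMap.smul_apply]
    rw [dualDistrib_toDual, ← hzf, enorm_smul, hn, inner_self_eq_norm_sq_to_K, enorm_pow]
    have : ‖(‖z‖ : 𝕜)‖ₑ = ‖z‖ₑ := by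
      rw [← ofReal_norm, ← ofReal_norm]
      simp
    rw [this, pow_two, ← mul_assoc, hz1, one_mul]

theorem traceDualNorm_transposeNorm_g2 [CompleteSpace H] [CompleteSpace K] (z : H ⊗[𝕜] K) :
    traceDualNorm (transposeNorm (g2 𝕜)) H K z = ‖z‖ₑ := by
  rw [← TensorProduct.enorm_comm, ← traceDualNorm_g2]
  have e : ∀ (φ : StrongDual 𝕜 H ⊗[𝕜] StrongDual 𝕜 K) (z : H ⊗[𝕜] K),
      TensorProduct.dualDistrib 𝕜 K H (TensorProduct.map (ContinuousLinearMap.coeLM 𝕜)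
        (ContinuousLinearMap.coeLM 𝕜) (TensorProduct.comm 𝕜 _ _ φ)) (TensorProduct.comm 𝕜 _ _ z)
      = TensorProduct.dualDistrib 𝕜 H K (TensorProduct.map (ContinuousLinearMap.coeLM 𝕜)
        (ContinuousLinearMap.coeLM 𝕜) φ) z := by
    intro φ z
    induction z with
    | zero => simp
    | add z z' hz hz' => simp only [map_add, hz, hz']
    | tmul x y =>
      induction φ with
      | zero => simp
      | add φ φ' hφ hφ' => simp only [map_add, LinearMap.add_apply, hφ, hφ']
      | tmul a b => simp [mul_comm]
  unfold traceDualNorm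
  refine (TensorProduct.comm 𝕜 (StrongDual 𝕜 H) (StrongDual 𝕜 K)).toEquiv.iSup_congr fun φ => ?_
  simp only [LinearEquiv.coe_toEquiv, e]
  rfl

/-- The finite hull of a functional that is the Hilbert norm on finite-dimensional subspaces. -/
theorem finHull_eq_enorm {α : TensorFunctional.{u, v} 𝕜} {H : Type u} {K : Type v}
    [NormedAddCommGroup H] [InnerProductSpace 𝕜 H] [NormedAddCommGroup K] [InnerProductSpace 𝕜 K]
    (h : ∀ (M : Submodule 𝕜 H) (N : Submodule 𝕜 K), FiniteDimensional 𝕜 M →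
      FiniteDimensional 𝕜 N → ∀ w : M ⊗[𝕜] N, α M N w = ‖w‖ₑ) (z : H ⊗[𝕜] K) :
    finHull α H K z = ‖z‖ₑ := by
  refine le_antisymm ?_ ?_
  · obtain ⟨M, N, hM, hN, hz⟩ := TensorProduct.exists_finite_submodule_of_setFinite {z}
      (Set.finite_singleton z)
    obtain ⟨w, hw⟩ := Set.singleton_subset_iff.1 hz
    refine iInf₂_le_of_le M hM <| iInf₂_le_of_le N hN <| iInf₂_le_of_le w hw ?_
    rw [h M N hM hN w, ← hw]
    -- Inclusions of subspaces are isometric for the Hilbert norm on tensors, so all representatives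
    -- `w` give the same value.
    exact (TensorProduct.enorm_map M.subtypeₗᵢ N.subtypeₗᵢ w).ge
  · refine le_iInf₂ fun M hM => le_iInf₂ fun N hN => le_iInf₂ fun w hw => ?_
    rw [h M N hM hN w, ← hw]
    exact (TensorProduct.enorm_map M.subtypeₗᵢ N.subtypeₗᵢ w).le

theorem dualNorm_g2 {H : Type u} {K : Type v} [NormedAddCommGroup H] [InnerProductSpace 𝕜 H]
    [NormedAddCommGroup K] [InnerProductSpace 𝕜 K] (z : H ⊗[𝕜] K) :
    dualNorm (g2 𝕜) H K z = ‖z‖ₑ :=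
  finHull_eq_enorm (fun M N _ _ w => by
    -- Riesz is needed only on the finite-dimensional subspaces, so `H` and `K` themselves need not
    -- be complete.
    have := FiniteDimensional.complete 𝕜 M
    have := FiniteDimensional.complete 𝕜 N
    exact traceDualNorm_g2 w) z

theorem adjointNorm_g2 {H : Type u} {K : Type v} [NormedAddCommGroup H] [InnerProductSpace 𝕜 H]
    [NormedAddCommGroup K] [InnerProductSpace 𝕜 K] (z : H ⊗[𝕜] K) :
    adjointNorm (g2 𝕜) H K z = ‖z‖ₑ :=
  finHull_eq_enorm (fun M N _ _ w => by
    have := FiniteDimensional.complete 𝕜 M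
    have := FiniteDimensional.complete 𝕜 N
    exact traceDualNorm_transposeNorm_g2 w) z

theorem existsUnique_g2Completion [CompleteSpace H] [CompleteSpace K] :
    ∃! V : HilbertTensor 𝕜 H K ≃ₗᵢ[𝕜] G2Completion 𝕜 H K,
      ∀ z : H ⊗[𝕜] K, V z = (G2Tensor.of 𝕜 H K z : G2Completion 𝕜 H K) := by
  let e₁ : H ⊗[𝕜] K →ₗ[𝕜] HilbertTensor 𝕜 H K :=
    (UniformSpace.Completion.toComplₗᵢ (𝕜 := 𝕜) (E := H ⊗[𝕜] K)).toLinearMap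
  let e₂ : G2Tensor 𝕜 H K →ₗ[𝕜] G2Completion 𝕜 H K :=
    (UniformSpace.Completion.toComplₗᵢ (𝕜 := 𝕜) (E := G2Tensor 𝕜 H K)).toLinearMap
  have h₁ : DenseRange e₁ := UniformSpace.Completion.denseRange_coe
  have h₂ : DenseRange e₂ := UniformSpace.Completion.denseRange_coe
  have hnorm : ∀ z, ‖e₂ (G2Tensor.of 𝕜 H K z)‖ = ‖e₁ z‖ := by
    intro z
    refine (UniformSpace.Completion.norm_coe _).trans
      (Eq.trans ?_ (UniformSpace.Completion.norm_coe z).symm)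
    rw [G2Tensor.norm_def, LinearEquiv.symm_apply_apply, g2_eq_enorm, toReal_enorm]
  refine ⟨(G2Tensor.of 𝕜 H K).extendOfIsometry e₁ e₂ h₁ h₂ hnorm,
    fun z => LinearEquiv.extendOfIsometry_eq _ _ _ h₁ h₂ hnorm z, fun V hV => ?_⟩
  refine HilbertTensor.isometryEquiv_ext fun x y => ?_
  exact (hV _).trans (LinearEquiv.extendOfIsometry_eq _ _ _ h₁ h₂ hnorm _).symm

end HilbertG2

/-! ### The main theorem -/

theorem mainTheorem8 {𝕜 : Type} [RCLike 𝕜]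
    (H : Type u) [NormedAddCommGroup H] [InnerProductSpace 𝕜 H] [CompleteSpace H]
    (K : Type v) [NormedAddCommGroup K] [InnerProductSpace 𝕜 K] [CompleteSpace K]
    (H₁ : Type u₁) [NormedAddCommGroup H₁] [InnerProductSpace 𝕜 H₁] [CompleteSpace H₁]
    (H₂ : Type u₂) [NormedAddCommGroup H₂] [InnerProductSpace 𝕜 H₂] [CompleteSpace H₂]
    (K₁ : Type v₁) [NormedAddCommGroup K₁] [InnerProductSpace 𝕜 K₁] [CompleteSpace K₁]
    (K₂ : Type v₂) [NormedAddCommGroup K₂] [InnerProductSpace 𝕜 K₂] [CompleteSpace K₂] :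
    -- `P₂(H̄, K) = N₂(H̄, K)`, with equal norms
    (∀ T : ConjSpace 𝕜 H →L[𝕜] K,
      (IsTwoSumming T ↔ IsTwoNuclear T) ∧ twoSummingNorm T = twoNuclearNorm T) ∧
    -- `H ⊗ K ≅ P₂(H̄, K)`, where `x ⊗ y` is mapped to `⟨·, J x⟩ y`
    (∃! U : HilbertTensor 𝕜 H K ≃ₗᵢ[𝕜] TwoSumming 𝕜 (ConjSpace 𝕜 H) K,
      ∀ (x : H) (y : K), TwoSumming.toCLM (U (htmul 𝕜 x y))
        = InnerProductSpace.rankOne 𝕜 y (ConjSpace.J (𝕜 := 𝕜) x)) ∧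
    -- `g₂` is a totally accessible tensor norm
    IsTensorNorm (g2.{u, v} 𝕜) ∧ IsTotallyAccessible (g2.{u, v} 𝕜) ∧
    -- on `H ⊗ K` it coincides with its transposed, adjoint and dual norms and the Hilbert norm
    (∀ z : H ⊗[𝕜] K, g2 𝕜 H K z = ‖z‖ₑ ∧ transposeNorm (g2 𝕜) H K z = ‖z‖ₑ ∧
      adjointNorm (g2 𝕜) H K z = ‖z‖ₑ ∧ dualNorm (g2 𝕜) H K z = ‖z‖ₑ) ∧
    -- the Hilbert space `H ⊗ K` is the completion of `H ⊗ K` with respect to `g₂`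
    (∃! V : HilbertTensor 𝕜 H K ≃ₗᵢ[𝕜] G2Completion 𝕜 H K,
      ∀ z : H ⊗[𝕜] K, V z = (G2Tensor.of 𝕜 H K z : G2Completion 𝕜 H K)) ∧
    -- `P₂(H₁, K₁) ⊗ P₂(H₂, K₂) ≅ P₂(H₁ ⊗ H₂, K₁ ⊗ K₂) ≅ P₂(H₁, K₂) ⊗ P₂(H₂, K₁)`
    (∃! V : HilbertTensor 𝕜 (TwoSumming 𝕜 H₁ K₁) (TwoSumming 𝕜 H₂ K₂) ≃ₗᵢ[𝕜]
        TwoSumming 𝕜 (HilbertTensor 𝕜 H₁ H₂) (HilbertTensor 𝕜 K₁ K₂),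
      ∀ S T x₁ x₂, TwoSumming.toCLM (V (htmul 𝕜 S T)) (htmul 𝕜 x₁ x₂)
        = htmul 𝕜 (TwoSumming.toCLM S x₁) (TwoSumming.toCLM T x₂)) ∧
    (∃! V : HilbertTensor 𝕜 (TwoSumming 𝕜 H₁ K₂) (TwoSumming 𝕜 H₂ K₁) ≃ₗᵢ[𝕜]
        TwoSumming 𝕜 (HilbertTensor 𝕜 H₁ H₂) (HilbertTensor 𝕜 K₁ K₂),
      ∀ S T x₁ x₂, TwoSumming.toCLM (V (htmul 𝕜 S T)) (htmul 𝕜 x₁ x₂)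
        = htmul 𝕜 (TwoSumming.toCLM T x₂) (TwoSumming.toCLM S x₁)) ∧
    -- `K₁` and its conjugate are isometrically isomorphic, and each such isomorphism `C` induces
    -- `P₂(H₁, K̄₁) ⊗ P₂(H₂, K₂) ≅ P₂(H₁ ⊗ H₂, K₁ ⊗ K₂) ≅ P₂(H₁, K₂) ⊗ P₂(H₂, K̄₁)`
    Nonempty (K₁ ≃ₗᵢ[𝕜] ConjSpace 𝕜 K₁) ∧
    (∀ C : K₁ ≃ₗᵢ[𝕜] ConjSpace 𝕜 K₁,
      (∃! V : HilbertTensor 𝕜 (TwoSumming 𝕜 H₁ (ConjSpace 𝕜 K₁)) (TwoSumming 𝕜 H₂ K₂) ≃ₗᵢ[𝕜]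
          TwoSumming 𝕜 (HilbertTensor 𝕜 H₁ H₂) (HilbertTensor 𝕜 K₁ K₂),
        ∀ S T x₁ x₂, TwoSumming.toCLM (V (htmul 𝕜 S T)) (htmul 𝕜 x₁ x₂)
          = htmul 𝕜 (C.symm (TwoSumming.toCLM S x₁)) (TwoSumming.toCLM T x₂)) ∧
      (∃! V : HilbertTensor 𝕜 (TwoSumming 𝕜 H₁ K₂) (TwoSumming 𝕜 H₂ (ConjSpace 𝕜 K₁)) ≃ₗᵢ[𝕜]
          TwoSumming 𝕜 (HilbertTensor 𝕜 H₁ H₂) (HilbertTensor 𝕜 K₁ K₂),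
        ∀ S T x₁ x₂, TwoSumming.toCLM (V (htmul 𝕜 S T)) (htmul 𝕜 x₁ x₂)
          = htmul 𝕜 (C.symm (TwoSumming.toCLM T x₂)) (TwoSumming.toCLM S x₁))) := by
  refine ⟨fun T => ⟨isTwoSumming_iff_isTwoNuclear T, twoSummingNorm_eq_twoNuclearNorm T⟩,
    TwoSumming.exists_isometryEquiv_conj, isTensorNorm_g2, isTotallyAccessible_g2,
    fun z => ⟨g2_eq_enorm z, (g2_eq_enorm _).trans (TensorProduct.enorm_comm z),
      adjointNorm_g2 z, dualNorm_g2 z⟩,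
    existsUnique_g2Completion, TwoSumming.existsUnique_tensor (.refl 𝕜 _), ?_,
    ConjSpace.nonempty_isometryEquiv K₁, fun C => ⟨?_, ?_⟩⟩
  -- Here `W` is the plain swap of the two factors; the conjugated versions use `C.symm` with or
  -- without a swap.
  · obtain ⟨W, hW⟩ := HilbertTensor.exists_comm_congr (K₂ := K₂) (LinearIsometryEquiv.refl 𝕜 K₁)
    simpa only [hW, LinearIsometryEquiv.coe_refl, id_eq] using
      TwoSumming.existsUnique_tensor (H₁ := H₁) (H₂ := H₂) W
  · obtain ⟨W, hW⟩ := HilbertTensor.exists_congr_left (K₂ := K₂) C.symm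
    simpa only [hW] using TwoSumming.existsUnique_tensor (H₁ := H₁) (H₂ := H₂) W
  · obtain ⟨W, hW⟩ := HilbertTensor.exists_comm_congr (K₂ := K₂) C.symm
    simpa only [hW] using TwoSumming.existsUnique_tensor (H₁ := H₁) (H₂ := H₂) W
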